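/- **Notation.** Let $b=(b_n)_{n\ge 0}\in\ell^2$ be a (real or complex) sequence, put $I_n=(-(n+1),-n]\cup[n,n+1)$, $H=\sum_{n\ge0}b_n\chi_{I_n}\in L^2(\mathbb R)$ and $F(z)=\sum_{n\ge 0}b_nz^n$. Let $\mathcal F f(\xi)=\frac1{\sqrt{2\pi}}\int_{\mathbb R}f(t)e^{-i\xi t}\,dt$ be the unitary Fourier transform on $L^2(\mathbb R)$ and $\operatorname{sinc}_F=\sqrt{\pi/2}\,\mathcal F^{-1}H\in L^2(\mathbb R)$. Let $$V_F=\Big\{\sum_{n\in\mathbb Z}c_n\operatorname{sinc}_F(\cdot-n\pi):\ F(1)=1,\ c\in\ell^2(\mathbb Z)\Big\}\subset L^2(\mathbb R),$$ the series converging in $L^2(\mathbb R)$ and $F(1)=1$ meaning that $\sum_n b_n$ converges with sum $1$. **Theorem.** (i) The two series $$\Phi(x,t)=\frac1\pi\operatorname{sinc}_F(t-x)\sum_{k\in\mathbb Z}e^{2ikx}=\sum_{k\in\mathbb Z}\delta(x-k\pi)\operatorname{sinc}_F(t-x)$$ converge (unconditionally, when tested against Schwartz functions of $(x,t)$) to one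 and the same tempered distribution $\Phi\in\mathcal S'(\mathbb R^2)$. (ii) Every $f\in V_F$ satisfies $f(t)=\int_{\mathbb R}f(x)\Phi(x,t)\,dx$ in the sense of distributions in $t$, for either form of $\Phi$. That is, for each $k$ the value $f(k\pi)=\lim_{R\to\infty}\frac1{\sqrt{2\pi}}\int_{-R}^{R}\mathcal Ff(\xi)e^{ik\pi\xi}\,d\xi$ exists, and for all $\psi\in\mathcal S(\mathbb R)$ $$\int_{\mathbb R} f\psi\,dt=\lim_{K\to\infty}\sum_{|k|\le K}\int_{\mathbb R}\Big(\frac1\pi\int_{\mathbb R} f(x)\operatorname{sinc}_F(t-x)e^{2ikx}\,dx\Big)\psi(t)\,dt=\sum_{k\in\mathbb Z}f(k\pi)\int_{\mathbb R}\operatorname{sinc}_F(t-k\pi)\psi(t)\,dt ,$$ the last series converging unconditionally. (iii) If moreover $b\in\ell^1$, then $\operatorname{sinc}_F$ and every $f\in V_F$ have continuous representatives, and with these the following holds for every fixed $t\in\mathbb R$: the two series in (i), tested against Schwartz functions of $x$, converge unconditionally to one and the same tempered distribution $\Phi(\cdot,t)\in\mathcal S'(\mathbb R)$, and for every $f\in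 V_F$ $$f(t)=\sum_{k\in\mathbb Z}\frac1\pi\int_{\mathbb R} f(x)\operatorname{sinc}_F(t-x)e^{2ikx}\,dx=\sum_{k\in\mathbb Z}f(k\pi)\operatorname{sinc}_F(t-k\pi),$$ both series converging unconditionally. -/

import Mathlib

open MeasureTheory Filter Topology
open scoped FourierTransform SchwartzMap ENNReal

noncomputable section

namespace SincF

/-- The symmetric set `I_n = (-(n+1), -n] ∪ [n, n+1)`. -/
def cell (n : ℕ) : Set ℝ :=
  Set.Ioc (-((n : ℝ) + 1)) (-(n : ℝ)) ∪ Set.Ico (n : ℝ) ((n : ℝ) + 1)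

/-- The symmetric cascade filter `H = ∑ₙ bₙ χ_{I_n}` (at each point at most one term is nonzero). -/
def cascadeFilter (b : ℕ → ℂ) (ξ : ℝ) : ℂ :=
  ∑' n : ℕ, (cell n).indicator (fun _ => b n) ξ

theorem mem_cell_iff (n : ℕ) (ξ : ℝ) : ξ ∈ cell n ↔ n = ⌊|ξ|⌋₊ := by
  rw [eq_comm, Nat.floor_eq_iff (abs_nonneg ξ)]
  simp only [cell, Set.mem_union, Set.mem_Ioc, Set.mem_Ico]
  have hn : (0 : ℝ) ≤ n := Nat.cast_nonneg n
  constructor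
  · rintro (⟨h1, h2⟩ | ⟨h1, h2⟩)
    · rw [abs_of_nonpos (by linarith)]; constructor <;> linarith
    · rw [abs_of_nonneg (by linarith)]; constructor <;> linarith
  · rintro ⟨h1, h2⟩
    rcases le_total 0 ξ with h | h
    · rw [abs_of_nonneg h] at h1 h2; right; constructor <;> linarith
    · rw [abs_of_nonpos h] at h1 h2; left; constructor <;> linarith

theorem cascadeFilter_eq (b : ℕ → ℂ) (ξ : ℝ) : cascadeFilter b ξ = b ⌊|ξ|⌋₊ := by
  unfold cascadeFilter
  rw [tsum_eq_single ⌊|ξ|⌋₊]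
  · rw [Set.indicator_of_mem ((mem_cell_iff _ _).2 rfl)]
  · intro n hn
    rw [Set.indicator_of_notMem]
    exact fun h => hn ((mem_cell_iff _ _).1 h)

theorem measurableSet_cell (n : ℕ) : MeasurableSet (cell n) :=
  measurableSet_Ioc.union measurableSet_Ico

theorem volume_cell_le (n : ℕ) : volume (cell n) ≤ 2 := by
  refine (measure_union_le _ _).trans ?_
  rw [Real.volume_Ioc, Real.volume_Ico, ← ENNReal.ofReal_add (by linarith) (by linarith)]
  ring_nf
  simp

/-- If `b ∈ ℓ²` then `H ∈ L²(ℝ)`. -/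
theorem memLp_cascadeFilter (b : lp (fun _ : ℕ => ℂ) 2) :
    MemLp (cascadeFilter b) 2 volume := by
  have hmeas : Measurable (cascadeFilter b) := by
    have : cascadeFilter b = fun ξ : ℝ => (b : ℕ → ℂ) ⌊|ξ|⌋₊ := funext (cascadeFilter_eq _)
    rw [this]
    exact (measurable_from_nat (f := (b : ℕ → ℂ))).comp (Nat.measurable_floor.comp measurable_norm)
  refine ⟨hmeas.aestronglyMeasurable, ?_⟩
  rw [eLpNorm_lt_top_iff_lintegral_rpow_enorm_lt_top two_ne_zero ENNReal.ofNat_ne_top]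
  have hpt : ∀ ξ : ℝ, ‖cascadeFilter b ξ‖ₑ ^ (2 : ℝ≥0∞).toReal
      = ∑' n : ℕ, (cell n).indicator (fun _ => ‖(b : ℕ → ℂ) n‖ₑ ^ (2 : ℝ≥0∞).toReal) ξ := by
    intro ξ
    rw [cascadeFilter_eq, tsum_eq_single ⌊|ξ|⌋₊]
    · rw [Set.indicator_of_mem ((mem_cell_iff _ _).2 rfl)]
    · intro n hn
      rw [Set.indicator_of_notMem]
      exact fun h => hn ((mem_cell_iff _ _).1 h)
  simp_rw [hpt]
  rw [lintegral_tsum fun n => (measurable_const.indicator (measurableSet_cell n)).aemeasurable]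
  simp_rw [lintegral_indicator_const (measurableSet_cell _)]
  have hb : Summable fun n : ℕ => ‖(b : ℕ → ℂ) n‖ ^ (2 : ℝ≥0∞).toReal :=
    (lp.memℓp b).summable (by norm_num)
  calc ∑' n : ℕ, ‖(b : ℕ → ℂ) n‖ₑ ^ (2 : ℝ≥0∞).toReal * volume (cell n)
      ≤ ∑' n : ℕ, ENNReal.ofReal (‖(b : ℕ → ℂ) n‖ ^ (2 : ℝ≥0∞).toReal) * 2 := by
        refine ENNReal.tsum_le_tsum fun n => ?_
        rw [← ENNReal.ofReal_rpow_of_nonneg (norm_nonneg _) (by norm_num), ofReal_norm]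
        gcongr
        exact volume_cell_le n
    _ < ∞ := by
        rw [ENNReal.tsum_mul_right]
        exact ENNReal.mul_lt_top (hb.tsum_ofReal_lt_top) (by norm_num)

theorem memLp_dilate {g : ℝ → ℂ} (hg : MemLp g 2 volume) :
    MemLp (fun η : ℝ => g (2 * Real.pi * η)) 2 volume := by
  have hc : (2 * Real.pi : ℝ) ≠ 0 := by positivity
  have hmap := Real.map_volume_mul_left hc
  have h : MemLp g 2 (Measure.map (fun η : ℝ => 2 * Real.pi * η) volume) := by
    have h2 := hg.smul_measure (c := ENNReal.ofReal |(2 * Real.pi)⁻¹|) ENNReal.ofReal_ne_top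
    rwa [← hmap] at h2
  exact h.comp_of_map (measurable_const_mul _).aemeasurable

/-- The inverse of the unitary Fourier transform
`(ℱ f)(ξ) = (2π)^{-1/2} ∫ f(t) e^{-iξt} dt` on `L²(ℝ)`,
i.e. the `L²`-extension of `g ↦ (2π)^{-1/2} ∫ g(ξ) e^{iξt} dξ`. Mathlib's `𝓕⁻` is the extension of
`g ↦ ∫ g(η) e^{2πiηt} dη`; the substitution `ξ = 2πη` gives the formula below. -/
def unitaryFourierInv (g : ℝ → ℂ) (hg : MemLp g 2 volume) : Lp ℂ 2 (volume : Measure ℝ) :=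
  ((Real.sqrt (2 * Real.pi) : ℝ) : ℂ) • 𝓕⁻ ((memLp_dilate hg).toLp _)

/-- The generalized sinc function `sinc_F = √(π/2) ℱ⁻¹ H`, an element of `L²(ℝ)`. -/
def sincF (b : lp (fun _ : ℕ => ℂ) 2) : Lp ℂ 2 (volume : Measure ℝ) :=
  ((Real.sqrt (Real.pi / 2) : ℝ) : ℂ) • unitaryFourierInv (cascadeFilter b) (memLp_cascadeFilter b)

/-- The translate `h(· - a)` of an `L²` function. -/
def translate (a : ℝ) (h : Lp ℂ 2 (volume : Measure ℝ)) : Lp ℂ 2 (volume : Measure ℝ) :=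
  Lp.compMeasurePreserving (fun t : ℝ => t - a) (measurePreserving_sub_right volume a) h

/-- The space `V_F` of all `∑ₙ cₙ sinc_F(· - nπ)`, `c ∈ ℓ²(ℤ)` (series in `L²(ℝ)`), where
`F(z) = ∑ bₙ zⁿ` is subject to `F(1) = ∑ bₙ = 1` (a convergent series). -/
def VF (b : lp (fun _ : ℕ => ℂ) 2) : Set (Lp ℂ 2 (volume : Measure ℝ)) :=
  {f | Tendsto (fun N : ℕ => ∑ n ∈ Finset.range N, (b : ℕ → ℂ) n) atTop (𝓝 1) ∧
    ∃ c : lp (fun _ : ℤ => ℂ) 2,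
      HasSum (fun n : ℤ => (c : ℤ → ℂ) n • translate (n * Real.pi) (sincF b)) f}

/-- `f ∈ L²(ℝ)` has the value `v` at `x`: the Fourier inversion integral
`(2π)^{-1/2} ∫_{-R}^{R} (ℱ f)(ξ) e^{iξx} dξ` tends to `v` as `R → ∞` (written with `ξ = 2πη`). -/
def HasValueAt (f : Lp ℂ 2 (volume : Measure ℝ)) (x : ℝ) (v : ℂ) : Prop :=
  Tendsto (fun R : ℝ => ∫ η in (-R)..R,
      ((𝓕 f : Lp ℂ 2 (volume : Measure ℝ)) : ℝ → ℂ) η *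
        Complex.exp (2 * Real.pi * Complex.I * η * x))
    atTop (𝓝 v)

/-- For fixed `t`, the `k`-th term `π⁻¹ s(t - x) e^{2ikx}` of the exponential form of the kernel,
integrated in `x` against `u`. -/
def expTermAt (s : ℝ → ℂ) (k : ℤ) (t : ℝ) (u : ℝ → ℂ) : ℂ :=
  (Real.pi : ℂ)⁻¹ * ∫ x : ℝ, u x * (s (t - x) * Complex.exp (2 * Complex.I * k * x))

/-- For fixed `t`, the `k`-th term `δ(x - kπ) s(t - x)` of the delta form of the kernel,
applied in `x` to `u`. -/
def deltaTermAt (s : ℝ → ℂ) (k : ℤ) (t : ℝ) (u : ℝ → ℂ) : ℂ :=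
  u (k * Real.pi) * s (t - k * Real.pi)

/-- The `k`-th term of the exponential form, as a distribution in `(x, t)`, applied to `u`. -/
def expTerm (s : ℝ → ℂ) (k : ℤ) (u : ℝ × ℝ → ℂ) : ℂ :=
  ∫ t : ℝ, expTermAt s k t (fun x => u (x, t))

/-- The `k`-th term of the delta form, as a distribution in `(x, t)`, applied to `u`. -/
def deltaTerm (s : ℝ → ℂ) (k : ℤ) (u : ℝ × ℝ → ℂ) : ℂ :=
  ∫ t : ℝ, deltaTermAt s k t (fun x => u (x, t))

end SincF

end

/-!
Everything takes place on the frequency side, with `η = ξ / (2π)` as frequency variable, so that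
`𝓕 (sinc_F) = π H(2πη)`. Translation by `nπ` multiplies the spectrum by a character of period
`1/π`, hence the spectrum of `f = ∑ cₙ sinc_F(· - nπ)` is `C(η) π H(2πη)`, where `C` is the
`L²` function on the circle `ℝ / π⁻¹ℤ` with Fourier coefficients `cₙ`
(`exists_fourier_eq_periodic_mul`). Two facts about the cells `I_n` carry the argument.

* The set `(2π)⁻¹ I_n` is a fundamental domain of this circle (`measurePreserving_mk_freqCell`).
  The Fourier inversion integral of `f` at `kπ`, taken over the cells of index below `N`, is
  therefore `c_k ∑_{n < N} bₙ`, and it tends to `c_k` because `F(1) = 1`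
  (`hasValueAt_of_fourier_eq`). So the delta form of the reproducing formula is the series that
  defines `f`, paired with a test function.
* Each class of unit intervals modulo `2` meets every cell exactly once
  (`bijective_cellIndex_sub_two_mul`). Multiplying the kernel by `e^{2ikx}` shifts a spectrum by
  `k/π`, and since `C` is invariant under this shift, the `k`-th exponential term has the spectrum
  `𝓕 f(η) H(2πη - 2k)` (`expTermAt_eq_fourierInv`). For almost every `η` the numbers
  `H(2πη - 2k)`, `k ∈ ℤ`, are the `bₙ` in another order. When `∑ bₙ` converges only conditionally,
  the symmetric partial sums over `|k| ≤ K` still converge to `1`, with a bound linear in `|η|`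
  (`periodSum_spec`); a test function absorbs this bound, and dominated convergence gives
  `tendsto_sum_expTerm`.

The two series for the kernel agree by Poisson summation over `πℤ`. After the shear
`(x, t) ↦ (x, t - x)` a test function `χ` is paired with `sinc_F` in the second variable; what
remains is a continuous function of `x` with quadratic decay, whose Fourier coefficients also decay
quadratically, because derivatives in `x` fall on `χ` alone (`exists_kernel_distribution`).

If `b ∈ ℓ¹`, then multiplication by `H(2π·)` maps `L¹` of the circle to `L¹(ℝ)`, all spectra are
integrable and Fourier inversion holds pointwise. The exponential series then sums by Fubini's
theorem, and the delta series is the image of the Fourier series of `C` under a bounded functional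
on `L²` of the circle (`hasSum_fourierCoeff_mul_sincRep`).
-/

noncomputable section

namespace SincF

/-! ### Characters of the line -/

/-- The character `x ↦ e^{2πix}` of the line, with complex values. -/
def wave (x : ℝ) : ℂ := Complex.exp ((2 * Real.pi * x : ℝ) * Complex.I)

@[simp] theorem norm_wave (x : ℝ) : ‖wave x‖ = 1 := Complex.norm_exp_ofReal_mul_I _

theorem wave_add (x y : ℝ) : wave (x + y) = wave x * wave y := by
  rw [wave, wave, wave, ← Complex.exp_add]; congr 1; push_cast; ring

@[simp] theorem wave_zero : wave 0 = 1 := by simp [wave]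

@[fun_prop] theorem continuous_wave : Continuous wave := by unfold wave; fun_prop

theorem fourierInv_eq_integral_wave (f : ℝ → ℂ) (t : ℝ) :
    𝓕⁻ f t = ∫ η, f η * wave (η * t) := by
  rw [Real.fourierInv_eq']
  congr 1; ext η
  rw [smul_eq_mul, mul_comm, wave]
  simp [mul_comm]

theorem fourier_eq_integral_wave (f : ℝ → ℂ) (t : ℝ) :
    𝓕 f t = ∫ η, f η * wave (-(η * t)) := by
  rw [Real.fourier_eq']
  congr 1; ext η
  rw [smul_eq_mul, mul_comm, wave]
  simp [mul_comm]

theorem integrable_mul_wave {f : ℝ → ℂ} (hf : Integrable f) {w : ℝ → ℝ} (hw : Continuous w) :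
    Integrable (fun x => f x * wave (w x)) :=
  hf.mul_bdd (c := 1) (continuous_wave.comp hw).aestronglyMeasurable
    (Eventually.of_forall fun x => by simp)

theorem memLp_mul_wave {f : ℝ → ℂ} (hf : MemLp f 2 volume) {w : ℝ → ℝ} (hw : Continuous w) :
    MemLp (fun x => f x * wave (w x)) 2 volume :=
  hf.of_le (hf.1.mul (continuous_wave.comp hw).aestronglyMeasurable)
    (Eventually.of_forall fun x => by simp)

/-! ### The Fourier transform on `L²(ℝ)` -/

theorem integrable_mul_of_memLp_two {f g : ℝ → ℂ} (hf : MemLp f 2 volume) (hg : MemLp g 2 volume) :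
    Integrable (fun x => f x * g x) :=
  hf.integrable_mul hg

theorem continuous_integral_mul {w : ℝ → ℂ} (hw : MemLp w 2 volume) :
    Continuous fun f : Lp ℂ 2 (volume : Measure ℝ) => ∫ x, f x * w x := by
  have h : ∀ f : Lp ℂ 2 (volume : Measure ℝ),
      ∫ x, f x * w x = inner ℂ (hw.star.toLp (star w)) f := by
    intro f
    rw [L2.inner_def]
    refine integral_congr_ae ?_
    filter_upwards [hw.star.coeFn_toLp] with x hx
    simp [hx]
  simp_rw [h]
  exact continuous_const.inner continuous_id

/-- Parseval's formula in bilinear form, one factor being a Schwartz function. -/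
theorem integral_mul_schwartz (f : Lp ℂ 2 (volume : Measure ℝ)) (ψ : 𝓢(ℝ, ℂ)) :
    ∫ x, f x * ψ x = ∫ η, (𝓕 f : Lp ℂ 2 (volume : Measure ℝ)) η * 𝓕⁻ (ψ : ℝ → ℂ) η := by
  have h := congrArg (fun T : 𝓢'(ℝ, ℂ) => T ψ)
    (Lp.fourierInv_toTemperedDistribution_eq (𝓕 f : Lp ℂ 2 (volume : Measure ℝ)))
  simp only [FourierTransform.fourierInv_fourier_eq, TemperedDistribution.fourierInv_apply,
    Lp.toTemperedDistribution_apply, smul_eq_mul] at h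
  simp_rw [mul_comm _ (ψ _), ← h, SchwartzMap.fourierInv_coe, mul_comm]

theorem memLp_comp_sub_left {f : ℝ → ℂ} (hf : MemLp f 2 volume) (t : ℝ) :
    MemLp (fun x => f (t - x)) 2 volume :=
  hf.comp_measurePreserving (Measure.measurePreserving_sub_left volume t)

theorem memLp_comp_sub_right {f : ℝ → ℂ} (hf : MemLp f 2 volume) (t : ℝ) :
    MemLp (fun x => f (x - t)) 2 volume :=
  hf.comp_measurePreserving (measurePreserving_sub_right volume t)

/-- Fubini's theorem for the inverse Fourier integral. -/
theorem integral_fourierInv_mul_flip {f g : ℝ → ℂ} (hf : Integrable f) (hg : Integrable g) :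
    ∫ x, 𝓕⁻ f x * g x = ∫ x, f x * 𝓕⁻ g x := by
  have h := VectorFourier.integral_fourierIntegral_smul_eq_flip (L := innerₗ ℝ) (μ := volume)
    (ν := volume) Real.continuous_fourierChar continuous_inner hf hg.comp_neg
  rw [flip_innerₗ] at h
  calc ∫ x, 𝓕⁻ f x * g x = ∫ x, 𝓕 f x * g (-x) := by
        rw [← integral_neg_eq_self]
        simp_rw [Real.fourierInv_eq_fourier_neg, neg_neg]
    _ = ∫ x, f x * 𝓕 (fun x => g (-x)) x := h
    _ = ∫ x, f x * 𝓕⁻ g x := by rw [Real.fourierInv_eq_fourier_comp_neg]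

theorem integral_convolution_modulated_schwartz (f s : 𝓢(ℝ, ℂ)) (t a : ℝ) :
    ∫ x, f x * (s (t - x) * wave (a * x)) =
      ∫ η, 𝓕 (f : ℝ → ℂ) (η - a) * 𝓕 (s : ℝ → ℂ) η * wave (η * t) := by
  have hw : Integrable (fun y => f (t - y) * wave (a * (t - y))) :=
    integrable_mul_wave (f.integrable.comp_sub_left t) (by fun_prop)
  have h1 : ∫ x, f x * (s (t - x) * wave (a * x)) =
      ∫ y, (f (t - y) * wave (a * (t - y))) * s y := by
    rw [← integral_sub_left_eq_self _ volume t]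
    congr 1; ext y; simp only [sub_sub_cancel]; ring
  have h2 : ∫ y, (f (t - y) * wave (a * (t - y))) * s y =
      ∫ η, 𝓕⁻ (fun y => f (t - y) * wave (a * (t - y))) η * 𝓕 (s : ℝ → ℂ) η := by
    rw [← SchwartzMap.fourier_coe, integral_fourierInv_mul_flip hw (𝓕 s).integrable]
    rw [← SchwartzMap.fourierInv_coe, FourierTransform.fourierInv_fourier_eq]
  rw [h1, h2]
  congr 1; ext η
  have h4 : 𝓕⁻ (fun y => f (t - y) * wave (a * (t - y))) η =
      𝓕 (f : ℝ → ℂ) (η - a) * wave (η * t) := by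
    rw [fourierInv_eq_integral_wave, fourier_eq_integral_wave, ← integral_mul_const,
      ← integral_sub_left_eq_self _ volume t]
    congr 1; ext y
    simp only [sub_sub_cancel, mul_assoc, ← wave_add]
    ring_nf
  rw [h4]; ring

/-- The Fourier transform of a modulated convolution of two `L²` functions: the identity
extends from Schwartz functions because both sides are continuous in each factor separately. -/
theorem integral_convolution_modulated (f s : Lp ℂ 2 (volume : Measure ℝ)) (t a : ℝ) :
    ∫ x, f x * (s (t - x) * wave (a * x)) =
      ∫ η, (𝓕 f : Lp ℂ 2 (volume : Measure ℝ)) (η - a) *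
        (𝓕 s : Lp ℂ 2 (volume : Measure ℝ)) η * wave (η * t) := by
  have hF : Continuous fun f : Lp ℂ 2 (volume : Measure ℝ) =>
      (𝓕 f : Lp ℂ 2 (volume : Measure ℝ)) :=
    (Lp.fourierTransformₗᵢ ℝ ℂ).continuous
  -- Schwartz functions are dense in `L²`; the two factors are approximated one after the other.
  have hden := SchwartzMap.denseRange_toLpCLM (E := ℝ) (F := ℂ) (p := 2) (μ := volume)
    ENNReal.ofNat_ne_top
  have hcs : ∀ f : Lp ℂ 2 (volume : Measure ℝ), Continuous fun s : Lp ℂ 2 (volume : Measure ℝ) =>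
      ∫ x, f x * (s (t - x) * wave (a * x)) := by
    intro f
    have h := continuous_integral_mul (memLp_mul_wave (memLp_comp_sub_left (Lp.memLp f) t)
      (w := fun y => a * (t - y)) (by fun_prop))
    refine h.congr fun s => ?_
    rw [← integral_sub_left_eq_self _ volume t]
    congr 1; ext y; simp only [sub_sub_cancel]; ring
  have hcs' : ∀ f : Lp ℂ 2 (volume : Measure ℝ), Continuous fun s : Lp ℂ 2 (volume : Measure ℝ) =>
      ∫ η, f (η - a) * (𝓕 s : Lp ℂ 2 (volume : Measure ℝ)) η * wave (η * t) := by
    intro f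
    have h := (continuous_integral_mul (memLp_mul_wave (memLp_comp_sub_right (Lp.memLp f) a)
      (w := fun y => y * t) (by fun_prop))).comp hF
    refine h.congr fun s => ?_
    simp only [Function.comp_apply]
    congr 1; ext y; ring
  have hcf : ∀ s : Lp ℂ 2 (volume : Measure ℝ), Continuous fun f : Lp ℂ 2 (volume : Measure ℝ) =>
      ∫ x, f x * (s (t - x) * wave (a * x)) := fun s =>
    continuous_integral_mul (memLp_mul_wave (memLp_comp_sub_left (Lp.memLp s) t) (by fun_prop))
  have hcf' : ∀ s : Lp ℂ 2 (volume : Measure ℝ), Continuous fun f : Lp ℂ 2 (volume : Measure ℝ) =>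
      ∫ η, (𝓕 f : Lp ℂ 2 (volume : Measure ℝ)) (η - a) * s η * wave (η * t) := by
    intro s
    have hs : MemLp (fun η => s (η - (-a)) * wave ((η + a) * t)) 2 volume :=
      memLp_mul_wave (memLp_comp_sub_right (Lp.memLp s) (-a)) (by fun_prop)
    refine ((continuous_integral_mul hs).comp hF).congr fun f => ?_
    simp only [Function.comp_apply]
    rw [← integral_sub_right_eq_self _ a]
    congr 1; ext y
    rw [show y - a - -a = y by ring, show y - a + a = y by ring]; ring
  refine hden.induction_on (p := fun s => ∫ x, f x * (s (t - x) * wave (a * x)) =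
      ∫ η, (𝓕 f : Lp ℂ 2 (volume : Measure ℝ)) (η - a) *
        (𝓕 s : Lp ℂ 2 (volume : Measure ℝ)) η * wave (η * t)) s
    (isClosed_eq (hcs f) (hcs' _)) fun s => ?_
  refine hden.induction_on (p := fun f => ∫ x, f x * (SchwartzMap.toLpCLM ℝ ℂ 2 volume s (t - x) *
      wave (a * x)) = ∫ η, (𝓕 f : Lp ℂ 2 (volume : Measure ℝ)) (η - a) *
        (𝓕 (SchwartzMap.toLpCLM ℝ ℂ 2 volume s) : Lp ℂ 2 (volume : Measure ℝ)) η *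
          wave (η * t)) f
    (isClosed_eq (hcf _) (hcf' _)) fun f => ?_
  simp only [SchwartzMap.toLpCLM_apply, SchwartzMap.toLp_fourier_eq]
  have h1 := f.coeFn_toLp 2 volume
  have h2 := (Measure.measurePreserving_sub_left volume t).quasiMeasurePreserving.ae_eq_comp
    (s.coeFn_toLp 2 volume)
  have h3 := (measurePreserving_sub_right volume a).quasiMeasurePreserving.ae_eq_comp
    ((𝓕 f).coeFn_toLp 2 volume)
  have h4 := (𝓕 s).coeFn_toLp 2 volume
  have e1 : ∫ x, f.toLp 2 volume x * (s.toLp 2 volume (t - x) * wave (a * x)) =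
      ∫ x, f x * (s (t - x) * wave (a * x)) := by
    refine integral_congr_ae ?_
    filter_upwards [h1, h2] with x hx hy
    simp only [Function.comp_apply] at hy
    rw [hx, hy]
  have e2 : ∫ η, (𝓕 f).toLp 2 volume (η - a) * (𝓕 s).toLp 2 volume η * wave (η * t) =
      ∫ η, 𝓕 (f : ℝ → ℂ) (η - a) * 𝓕 (s : ℝ → ℂ) η * wave (η * t) := by
    refine integral_congr_ae ?_
    filter_upwards [h3, h4] with x hx hy
    simp only [Function.comp_apply] at hx
    rw [hx, hy, SchwartzMap.fourier_coe, SchwartzMap.fourier_coe]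
  rw [e1, e2, integral_convolution_modulated_schwartz]

/-- Locally integrable functions with the same integrals against Schwartz functions agree. -/
theorem ae_eq_of_integral_mul_schwartz_eq {f g : ℝ → ℂ} (hf : LocallyIntegrable f)
    (hg : LocallyIntegrable g) (h : ∀ ψ : 𝓢(ℝ, ℂ), ∫ x, f x * ψ x = ∫ x, g x * ψ x) :
    f =ᵐ[volume] g := by
  refine ae_eq_of_integral_contDiff_smul_eq hf hg fun φ hφ hc => ?_
  have hc' : HasCompactSupport fun x => (φ x : ℂ) := hc.comp_left Complex.ofReal_zero
  have hs : ContDiff ℝ ((⊤ : ℕ∞) : WithTop ℕ∞) fun x => (φ x : ℂ) := Complex.ofRealCLM.contDiff.comp hφ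
  have h2 := h (hc'.toSchwartzMap hs)
  simp only [HasCompactSupport.toSchwartzMap_toFun] at h2
  simpa [mul_comm] using h2

theorem continuous_fourierInv {h : ℝ → ℂ} (h1 : Integrable h) : Continuous (𝓕⁻ h) := by
  rw [Real.fourierInv_eq_fourier_comp_neg]
  exact VectorFourier.fourierIntegral_continuous Real.continuous_fourierChar continuous_inner
    h1.comp_neg

/-- For an integrable function in `L²` the inverse Fourier transform of `L²` is given by the
inverse Fourier integral. -/
theorem fourierInv_toLp_ae_eq {h : ℝ → ℂ} (h1 : Integrable h) (h2 : MemLp h 2 volume) :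
    (𝓕⁻ (h2.toLp h) : Lp ℂ 2 (volume : Measure ℝ)) =ᵐ[volume] 𝓕⁻ h := by
  refine ae_eq_of_integral_mul_schwartz_eq ((Lp.memLp _).locallyIntegrable one_le_two)
    (continuous_fourierInv h1).locallyIntegrable fun ψ => ?_
  rw [integral_mul_schwartz, FourierTransform.fourier_fourierInv_eq,
    integral_fourierInv_mul_flip h1 ψ.integrable]
  refine integral_congr_ae ?_
  filter_upwards [h2.coeFn_toLp] with x hx
  rw [hx]

theorem coeFn_translate (a : ℝ) (h : Lp ℂ 2 (volume : Measure ℝ)) :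
    translate a h =ᵐ[volume] fun t => h (t - a) :=
  Lp.coeFn_compMeasurePreserving h (measurePreserving_sub_right volume a)

theorem fourier_translate (a : ℝ) (h : Lp ℂ 2 (volume : Measure ℝ)) :
    (𝓕 (translate a h) : Lp ℂ 2 (volume : Measure ℝ)) =ᵐ[volume]
      fun η => (𝓕 h : Lp ℂ 2 (volume : Measure ℝ)) η * wave (-(η * a)) := by
  have hm := memLp_mul_wave (Lp.memLp (𝓕 h : Lp ℂ 2 (volume : Measure ℝ)))
    (w := fun η => -(η * a)) (by fun_prop)
  refine ae_eq_of_integral_mul_schwartz_eq ((Lp.memLp _).locallyIntegrable one_le_two)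
    (hm.locallyIntegrable one_le_two) fun ψ => ?_
  have key := fun (u : Lp ℂ 2 (volume : Measure ℝ)) (t : ℝ) =>
    integral_convolution_modulated u (𝓕⁻ (ψ.toLp 2 volume) : Lp ℂ 2 (volume : Measure ℝ)) t 0
  simp only [FourierTransform.fourier_fourierInv_eq, zero_mul, wave_zero, mul_one, sub_zero] at key
  have hψ := ψ.coeFn_toLp 2 volume
  have e1 : ∀ (u : Lp ℂ 2 (volume : Measure ℝ)) (t : ℝ),
      ∫ η, u η * ψ.toLp 2 volume η * wave (η * t) = ∫ η, u η * ψ η * wave (η * t) := by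
    intro u t
    refine integral_congr_ae ?_
    filter_upwards [hψ] with x hx
    rw [hx]
  simp only [e1] at key
  -- `∫ h(x - a) g(-x) dx = ∫ h(x) g(-a - x) dx`: the convolution with `g = 𝓕⁻ ψ` is taken at `0`
  -- for the translate and at `-a` for `h`.
  have k1 := key (translate a h) 0
  have k2 := key h (-a)
  simp only [mul_zero, wave_zero, mul_one] at k1
  rw [← k1]
  calc _ = ∫ x, h (x - a) * (𝓕⁻ (ψ.toLp 2 volume) : Lp ℂ 2 (volume : Measure ℝ)) (0 - x) := by
        refine integral_congr_ae ?_
        filter_upwards [coeFn_translate a h] with x hx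
        rw [hx]
    _ = ∫ x, h x * (𝓕⁻ (ψ.toLp 2 volume) : Lp ℂ 2 (volume : Measure ℝ)) (-a - x) := by
        rw [← integral_sub_right_eq_self (fun x => h x *
          (𝓕⁻ (ψ.toLp 2 volume) : Lp ℂ 2 (volume : Measure ℝ)) (-a - x)) a]
        congr 1; ext x; congr 2; ring
    _ = _ := by
        rw [k2]; congr 1; ext x
        rw [mul_neg]; ring

theorem sincF_eq_smul_fourierInv (b : lp (fun _ : ℕ => ℂ) 2) :
    sincF b = (Real.pi : ℂ) • 𝓕⁻ ((memLp_dilate (memLp_cascadeFilter b)).toLp _) := by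
  have hc : ((Real.sqrt (Real.pi / 2) : ℝ) : ℂ) * ((Real.sqrt (2 * Real.pi) : ℝ) : ℂ) =
      (Real.pi : ℂ) := by
    rw [← Complex.ofReal_mul, ← Real.sqrt_mul (by positivity),
      show Real.pi / 2 * (2 * Real.pi) = Real.pi ^ 2 by ring, Real.sqrt_sq Real.pi_pos.le]
  rw [sincF, unitaryFourierInv, smul_smul, hc]

/-- On the frequency side the generalized sinc function is the dilated cascade filter. -/
theorem fourier_sincF (b : lp (fun _ : ℕ => ℂ) 2) :
    (𝓕 (sincF b) : Lp ℂ 2 (volume : Measure ℝ)) =ᵐ[volume]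
      fun η => Real.pi * cascadeFilter b (2 * Real.pi * η) := by
  rw [sincF_eq_smul_fourierInv, FourierTransform.fourier_smul,
    FourierTransform.fourier_fourierInv_eq]
  filter_upwards [Lp.coeFn_smul (Real.pi : ℂ) ((memLp_dilate (memLp_cascadeFilter b)).toLp _),
    (memLp_dilate (memLp_cascadeFilter b)).coeFn_toLp] with η h1 h2
  rw [h1, Pi.smul_apply, h2, smul_eq_mul]

/-! ### Frequency cells as fundamental domains of the circle -/

instance : Fact (0 < (Real.pi⁻¹ : ℝ)) := ⟨by positivity⟩

/-- The circle of frequencies: the characters `η ↦ e^{-2πiη·nπ}` have period `1/π`. -/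
abbrev FreqCircle : Type := AddCircle (Real.pi⁻¹ : ℝ)

/-- The dilated cell `(2π)⁻¹ I_n`. -/
def freqCell (n : ℕ) : Set ℝ := {η | ⌊|2 * Real.pi * η|⌋₊ = n}

theorem measurableSet_freqCell (n : ℕ) : MeasurableSet (freqCell n) := by
  have : Measurable fun η : ℝ => ⌊|2 * Real.pi * η|⌋₊ :=
    Nat.measurable_floor.comp (measurable_norm.comp (measurable_const_mul _))
  exact this (measurableSet_singleton n)

theorem pairwise_disjoint_freqCell : Pairwise (Function.onFun Disjoint freqCell) := by
  intro m n hmn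
  rw [Function.onFun, Set.disjoint_left]
  rintro η rfl h
  exact hmn h

theorem iUnion_freqCell : ⋃ n, freqCell n = Set.univ :=
  Set.eq_univ_of_forall fun _ => Set.mem_iUnion.2 ⟨_, rfl⟩

theorem cascadeFilter_of_mem_freqCell (b : ℕ → ℂ) {n : ℕ} {η : ℝ} (h : η ∈ freqCell n) :
    cascadeFilter b (2 * Real.pi * η) = b n := by
  rw [cascadeFilter_eq]; congr 1

/-- Up to end points, a frequency cell consists of one half of a period interval and of a translate
of the other half by a multiple of the period. -/
theorem freqCell_ae_eq (n : ℕ) : freqCell n =ᵐ[volume]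
    (Set.Ioc (n * (Real.pi⁻¹ / 2)) ((n + 1) * (Real.pi⁻¹ / 2)) ∪
      (fun η => η + (n + 1) * Real.pi⁻¹) ⁻¹'
        Set.Ioc ((n + 1) * (Real.pi⁻¹ / 2)) ((n + 2) * (Real.pi⁻¹ / 2)) : Set ℝ) := by
  have hπ := Real.pi_pos
  have hc : freqCell n = (fun η => 2 * Real.pi * η) ⁻¹' cell n := by
    ext η; rw [Set.mem_preimage, mem_cell_iff, eq_comm]; rfl
  have hn : ∀ᵐ η : ℝ, η ≠ n * (Real.pi⁻¹ / 2) ∧ η ≠ (n + 1) * (Real.pi⁻¹ / 2) :=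
    (Measure.ae_ne volume _).and (Measure.ae_ne volume _)
  filter_upwards [hn] with η ⟨h1, h2⟩
  have e1 : η = 2 * Real.pi * η * (Real.pi⁻¹ / 2) := by field_simp
  have hp : 0 < Real.pi⁻¹ / 2 := by positivity
  rw [hc]
  apply propext
  change 2 * Real.pi * η ∈ cell n ↔ η ∈ Set.Ioc _ _ ∨ η + (n + 1) * Real.pi⁻¹ ∈ Set.Ioc _ _
  rw [show η + (n + 1) * Real.pi⁻¹ = (2 * Real.pi * η + 2 * (n + 1)) * (Real.pi⁻¹ / 2) by
    field_simp]
  have e3 : η ∈ Set.Ioc (n * (Real.pi⁻¹ / 2)) ((n + 1) * (Real.pi⁻¹ / 2)) ↔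
      2 * Real.pi * η ∈ Set.Ioc (n : ℝ) (n + 1) := by
    conv_lhs => rw [e1]
    simp only [Set.mem_Ioc, mul_lt_mul_iff_left₀ hp, mul_le_mul_iff_left₀ hp]
  rw [e3]
  simp only [Set.mem_Ioc, mul_lt_mul_iff_left₀ hp, mul_le_mul_iff_left₀ hp, cell, Set.mem_union,
    Set.mem_Ico]
  have h1' : 2 * Real.pi * η ≠ n := fun h => h1 (by rw [← h, ← e1])
  have h2' : 2 * Real.pi * η ≠ n + 1 := fun h => h2 (by rw [← h, ← e1])
  -- What remains is a comparison of the end points of four unit intervals.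
  generalize 2 * Real.pi * η = x at *
  constructor
  · rintro (⟨ha, hb⟩ | ⟨ha, hb⟩)
    · right; constructor <;> linarith
    · left; exact ⟨lt_of_le_of_ne ha h1'.symm, hb.le⟩
  · rintro (⟨ha, hb⟩ | ⟨ha, hb⟩)
    · right; exact ⟨ha.le, lt_of_le_of_ne hb h2'⟩
    · left; constructor <;> linarith

/-- Every frequency cell is a fundamental domain of the circle: its left half becomes adjacent to
its right half after a shift by `n + 1` periods. -/
theorem measurePreserving_mk_freqCell (n : ℕ) :
    MeasurePreserving ((↑) : ℝ → FreqCircle) (volume.restrict (freqCell n)) volume := by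
  have hπ := Real.pi_pos
  have hmk : Measurable ((↑) : ℝ → FreqCircle) := AddCircle.measurable_mk'
  refine ⟨hmk, ?_⟩
  set a : ℝ := n * (Real.pi⁻¹ / 2) with ha
  set m : ℝ := (n + 1) * (Real.pi⁻¹ / 2) with hm
  set e : ℝ := (n + 2) * (Real.pi⁻¹ / 2) with he
  set c : ℝ := (n + 1) * Real.pi⁻¹ with hc
  have hp : 0 < Real.pi⁻¹ / 2 := by positivity
  have ham : a ≤ m := by rw [ha, hm]; gcongr; linarith
  have hme : m ≤ e := by rw [he, hm]; gcongr; linarith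
  have hae : e = a + Real.pi⁻¹ := by rw [he, ha]; ring
  have hB : MeasurePreserving (fun η => η + c)
      (volume.restrict ((fun η => η + c) ⁻¹' Set.Ioc m e)) (volume.restrict (Set.Ioc m e)) :=
    (measurePreserving_add_right volume c).restrict_preimage measurableSet_Ioc
  have hmkc : ((↑) : ℝ → FreqCircle) ∘ (fun η => η + c) = (↑) := by
    ext η
    simp only [Function.comp_apply]
    rw [AddCircle.coe_add, hc, show ((n : ℝ) + 1) * Real.pi⁻¹ = (n + 1 : ℕ) • Real.pi⁻¹ by
      rw [nsmul_eq_mul]; push_cast; ring, AddCircle.coe_nsmul, AddCircle.coe_period, smul_zero,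
      add_zero]
  have hdis : Disjoint (Set.Ioc a m) ((fun η => η + c) ⁻¹' Set.Ioc m e) := by
    rw [Set.disjoint_left]
    rintro η ⟨h1, _⟩ ⟨_, h4⟩
    have : c = (n + 1) * (Real.pi⁻¹ / 2) + (n + 1) * (Real.pi⁻¹ / 2) := by rw [hc]; ring
    have hn : (0 : ℝ) ≤ n * (Real.pi⁻¹ / 2) := by positivity
    simp only [he, ha] at *
    nlinarith
  have hmB : MeasurableSet ((fun η => η + c) ⁻¹' Set.Ioc m e) :=
    (measurable_add_const c) measurableSet_Ioc
  rw [Measure.restrict_congr_set (freqCell_ae_eq n), Measure.restrict_union hdis hmB,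
    Measure.map_add _ _ hmk]
  have h1 : Measure.map ((↑) : ℝ → FreqCircle)
      (volume.restrict ((fun η => η + c) ⁻¹' Set.Ioc m e)) =
      Measure.map ((↑) : ℝ → FreqCircle) (volume.restrict (Set.Ioc m e)) := by
    rw [← hB.map_eq, Measure.map_map hmk hB.measurable, hmkc]
  rw [h1, ← Measure.map_add _ _ hmk, ← Measure.restrict_union (Set.Ioc_disjoint_Ioc_of_le le_rfl)
    measurableSet_Ioc, Set.Ioc_union_Ioc_eq_Ioc ham hme, hae]
  exact (AddCircle.measurePreserving_mk Real.pi⁻¹ a).map_eq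

theorem quasiMeasurePreserving_mk :
    Measure.QuasiMeasurePreserving ((↑) : ℝ → FreqCircle) volume volume := by
  refine ⟨AddCircle.measurable_mk', Measure.AbsolutelyContinuous.mk fun s hs h0 => ?_⟩
  rw [Measure.map_apply AddCircle.measurable_mk' hs]
  have h1 : ∀ n, volume.restrict (freqCell n) (((↑) : ℝ → FreqCircle) ⁻¹' s) = 0 := fun n => by
    rw [(measurePreserving_mk_freqCell n).measure_preimage hs.nullMeasurableSet, h0]
  rw [← Set.inter_univ (_ ⁻¹' s), ← iUnion_freqCell, Set.inter_iUnion, measure_iUnion_null_iff]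
  intro n
  rw [← Measure.restrict_apply (AddCircle.measurable_mk' hs)]
  exact h1 n

theorem ae_freqCircle_iff {p : FreqCircle → Prop} :
    (∀ᵐ x ∂AddCircle.haarAddCircle, p x) ↔ ∀ᵐ x, p x := by
  have hT : (0 : ℝ) < Real.pi⁻¹ := by positivity
  rw [AddCircle.volume_eq_smul_haarAddCircle,
    Measure.ae_ennreal_smul_measure_iff (by simpa using hT)]

theorem integrableOn_freqCell {p : FreqCircle → ℂ} (hp : Integrable p) (n : ℕ) :
    IntegrableOn (fun η : ℝ => p η) (freqCell n) :=
  (measurePreserving_mk_freqCell n).integrable_comp_of_integrable hp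

theorem setIntegral_freqCell {E : Type*} [NormedAddCommGroup E] [NormedSpace ℝ E]
    {p : FreqCircle → E} (hp : Integrable p) (n : ℕ) :
    ∫ η in freqCell n, p η = ∫ x, p x := by
  rw [← (measurePreserving_mk_freqCell n).map_eq, integral_map AddCircle.measurable_mk'.aemeasurable]
  rw [(measurePreserving_mk_freqCell n).map_eq]
  exact hp.1

/-- The monomial of degree `n` on the frequency circle, as a character of the line. -/
theorem fourier_coe_eq_wave (n : ℤ) (η : ℝ) :
    fourier n (η : FreqCircle) = wave (η * (n * Real.pi)) := by
  have hπ : (Real.pi : ℂ) ≠ 0 := by exact_mod_cast Real.pi_ne_zero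
  rw [fourier_coe_apply, wave]
  congr 1
  push_cast
  field_simp

/-! ### The frequency side of the space `V_F` -/

theorem exists_subseq_tendsto_ae {α : Type*} [MeasurableSpace α] {μ : Measure α}
    {u : ℕ → Lp ℂ 2 μ} {v : Lp ℂ 2 μ} (h : Tendsto u atTop (𝓝 v)) :
    ∃ ns : ℕ → ℕ, StrictMono ns ∧ ∀ᵐ x ∂μ, Tendsto (fun i => u (ns i) x) atTop (𝓝 (v x)) :=
  (tendstoInMeasure_of_tendsto_Lp h).exists_seq_tendsto_ae

/-- The Fourier transform of an element of `V_F` is a periodic function, with the coefficients of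
the element as Fourier coefficients, times the Fourier transform of the generalized sinc. -/
theorem exists_fourier_eq_periodic_mul (s f : Lp ℂ 2 (volume : Measure ℝ))
    (c : lp (fun _ : ℤ => ℂ) 2)
    (hf : HasSum (fun n : ℤ => (c : ℤ → ℂ) n • translate (n * Real.pi) s) f) :
    ∃ C : Lp ℂ 2 (AddCircle.haarAddCircle (T := (Real.pi⁻¹ : ℝ))),
      (∀ k : ℤ, fourierCoeff C (-k) = (c : ℤ → ℂ) k) ∧
      (𝓕 f : Lp ℂ 2 (volume : Measure ℝ)) =ᵐ[volume]
        fun η => C (η : FreqCircle) * (𝓕 s : Lp ℂ 2 (volume : Measure ℝ)) η := by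
  have hc' : Memℓp (fun n : ℤ => (c : ℤ → ℂ) (-n)) 2 := by
    rw [memℓp_gen_iff (by norm_num)]
    exact ((Equiv.neg ℤ).summable_iff (f := fun n => ‖(c : ℤ → ℂ) n‖ ^ (2 : ℝ≥0∞).toReal)).2
      ((lp.memℓp c).summable (by norm_num))
  set C : Lp ℂ 2 (AddCircle.haarAddCircle (T := (Real.pi⁻¹ : ℝ))) :=
    fourierBasis.repr.symm ⟨_, hc'⟩ with hC
  have hcoef : ∀ k : ℤ, fourierCoeff C (-k) = (c : ℤ → ℂ) k := by
    intro k
    rw [← fourierBasis_repr, hC, LinearIsometryEquiv.apply_symm_apply]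
    simp
  refine ⟨C, hcoef, ?_⟩
  have hsC : HasSum (fun n : ℤ => (c : ℤ → ℂ) n • fourierLp 2 (-n)) C := by
    refine ((Equiv.neg ℤ).hasSum_iff.2 (hasSum_fourier_series_L2 C)).congr_fun fun n => ?_
    simp [← hcoef n]
  have hsf : HasSum (fun n : ℤ => (c : ℤ → ℂ) n •
      (𝓕 (translate (n * Real.pi) s) : Lp ℂ 2 (volume : Measure ℝ))) (𝓕 f) := by
    have h := hf.mapL (Lp.fourierTransformₗᵢ ℝ ℂ).toContinuousLinearEquiv.toContinuousLinearMap
    refine h.congr_fun fun n => ?_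
    exact (FourierTransform.fourier_smul _ _).symm
  -- A common subsequence along which the partial sums of both series converge almost everywhere.
  obtain ⟨ns, hns, h1⟩ := exists_subseq_tendsto_ae (hsC.comp (Finset.tendsto_Icc_neg (R := ℤ)))
  obtain ⟨ms, hms, h2⟩ := exists_subseq_tendsto_ae
    ((hsf.comp (Finset.tendsto_Icc_neg (R := ℤ))).comp hns.tendsto_atTop)
  have h1' := quasiMeasurePreserving_mk.ae (ae_freqCircle_iff.1 h1)
  have e1 : ∀ N : ℕ, ∀ᵐ η : ℝ, (∑ n ∈ Finset.Icc (-(N : ℤ)) N,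
      (c : ℤ → ℂ) n • fourierLp 2 (-n) : Lp ℂ 2 (AddCircle.haarAddCircle (T := (Real.pi⁻¹ : ℝ))))
        (η : FreqCircle) = ∑ n ∈ Finset.Icc (-(N : ℤ)) N, (c : ℤ → ℂ) n * wave (-(η * (n * Real.pi)))
      := by
    intro N
    have h3 : ∀ᵐ x ∂(AddCircle.haarAddCircle (T := (Real.pi⁻¹ : ℝ))), ∀ n : ℤ,
        ((c : ℤ → ℂ) n • fourierLp 2 (-n) : Lp ℂ 2 (AddCircle.haarAddCircle (T := (Real.pi⁻¹ : ℝ))))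
          x = (c : ℤ → ℂ) n * fourier (-n) x := by
      rw [ae_all_iff]
      intro n
      filter_upwards [Lp.coeFn_smul ((c : ℤ → ℂ) n) (fourierLp (T := (Real.pi⁻¹ : ℝ)) 2 (-n)),
        coeFn_fourierLp (T := (Real.pi⁻¹ : ℝ)) 2 (-n)] with x hx hy
      rw [hx, Pi.smul_apply, hy, smul_eq_mul]
    have h4 := (Lp.coeFn_fun_finsetSum (Finset.Icc (-(N : ℤ)) N) fun n =>
      ((c : ℤ → ℂ) n • fourierLp 2 (-n) :
        Lp ℂ 2 (AddCircle.haarAddCircle (T := (Real.pi⁻¹ : ℝ))))).and h3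
    filter_upwards [quasiMeasurePreserving_mk.ae (ae_freqCircle_iff.1 h4)] with η hη
    rw [hη.1]
    refine Finset.sum_congr rfl fun n _ => ?_
    rw [hη.2, fourier_coe_eq_wave]
    push_cast
    ring_nf
  have e2 : ∀ N : ℕ, ∀ᵐ η : ℝ, (∑ n ∈ Finset.Icc (-(N : ℤ)) N, (c : ℤ → ℂ) n •
      (𝓕 (translate (n * Real.pi) s) : Lp ℂ 2 (volume : Measure ℝ)) : Lp ℂ 2 _) η =
        (∑ n ∈ Finset.Icc (-(N : ℤ)) N, (c : ℤ → ℂ) n * wave (-(η * (n * Real.pi)))) *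
          (𝓕 s : Lp ℂ 2 (volume : Measure ℝ)) η := by
    intro N
    have h3 : ∀ᵐ η : ℝ, ∀ n : ℤ, ((c : ℤ → ℂ) n •
        (𝓕 (translate (n * Real.pi) s) : Lp ℂ 2 (volume : Measure ℝ)) : Lp ℂ 2 _) η =
          (c : ℤ → ℂ) n * wave (-(η * (n * Real.pi))) *
            (𝓕 s : Lp ℂ 2 (volume : Measure ℝ)) η := by
      rw [ae_all_iff]
      intro n
      filter_upwards [Lp.coeFn_smul ((c : ℤ → ℂ) n) (𝓕 (translate (n * Real.pi) s) : Lp ℂ 2 _),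
        fourier_translate (n * Real.pi) s] with x hx hy
      rw [hx, Pi.smul_apply, hy, smul_eq_mul]
      ring
    filter_upwards [h3, Lp.coeFn_fun_finsetSum (Finset.Icc (-(N : ℤ)) N) fun n =>
      ((c : ℤ → ℂ) n • (𝓕 (translate (n * Real.pi) s) : Lp ℂ 2 (volume : Measure ℝ)))]
      with η hη hη'
    rw [hη', Finset.sum_mul]
    exact Finset.sum_congr rfl fun n _ => hη n
  filter_upwards [h1', h2, ae_all_iff.2 e1, ae_all_iff.2 e2] with η k1 k2 k3 k4
  have k1' := ((k1.comp hms.tendsto_atTop).mul_const ((𝓕 s : Lp ℂ 2 (volume : Measure ℝ)) η))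
  refine tendsto_nhds_unique k2 (k1'.congr fun i => ?_)
  simp only [Function.comp_apply]
  rw [k3, k4]

/-! ### Periodization of the cascade filter -/

/-- The index of the cell that contains the open interval `(i, i + 1)`. -/
def cellIndex (i : ℤ) : ℕ := (max i (-1 - i)).toNat

theorem cellIndex_reflect (i : ℤ) : cellIndex (-1 - i) = cellIndex i := by
  unfold cellIndex; omega

theorem floor_abs_eq_cellIndex {ξ : ℝ} (hξ : ∀ i : ℤ, ξ ≠ i) : ⌊|ξ|⌋₊ = cellIndex ⌊ξ⌋ := by
  have h1 := Int.floor_le ξ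
  have h2 := Int.lt_floor_add_one ξ
  have h3 := lt_of_le_of_ne h1 (hξ _).symm
  generalize ⌊ξ⌋ = i at *
  rw [Nat.floor_eq_iff (abs_nonneg ξ), cellIndex]
  rcases le_or_gt 0 i with hi | hi
  · have e : (((max i (-1 - i)).toNat : ℕ) : ℝ) = i := by
      rw [max_eq_left (by omega)]; exact_mod_cast Int.toNat_of_nonneg hi
    have : (0 : ℝ) ≤ i := by exact_mod_cast hi
    rw [e, abs_of_nonneg (by linarith)]
    exact ⟨h1, h2⟩
  · have e : (((max i (-1 - i)).toNat : ℕ) : ℝ) = -1 - i := by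
      rw [max_eq_right (by omega)]
      have := Int.toNat_of_nonneg (a := -1 - i) (by omega)
      have h : (((-1 - i).toNat : ℤ) : ℝ) = ((-1 - i : ℤ) : ℝ) := by rw [this]
      push_cast at h
      exact_mod_cast h
    have : (i : ℝ) + 1 ≤ 0 := by exact_mod_cast hi
    rw [e, abs_of_nonpos (by linarith)]
    constructor <;> linarith

theorem cascadeFilter_sub_two_mul (b : ℕ → ℂ) {ξ : ℝ} (hξ : ∀ i : ℤ, ξ ≠ i) (k : ℤ) :
    cascadeFilter b (ξ - 2 * k) = b (cellIndex (⌊ξ⌋ - 2 * k)) := by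
  have h : ∀ i : ℤ, ξ - 2 * k ≠ i := fun i hi => hξ (i + 2 * k) (by push_cast; linarith)
  rw [cascadeFilter_eq, floor_abs_eq_cellIndex h]
  congr 2
  rw [show (2 * k : ℝ) = ((2 * k : ℤ) : ℝ) by push_cast; ring, Int.floor_sub_intCast]

/-- Up to the null set of integers, each translate class of unit intervals modulo `2` meets every
cell exactly once. -/
theorem bijective_cellIndex_sub_two_mul (m : ℤ) :
    Function.Bijective fun k : ℤ => cellIndex (m - 2 * k) := by
  unfold cellIndex
  constructor
  · intro k l h
    simp only at h
    omega
  · intro n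
    rcases Int.emod_two_eq_zero_or_one (m - n) with h | h
    · exact ⟨(m - n) / 2, by simp only; omega⟩
    · exact ⟨(m + n + 1) / 2, by simp only; omega⟩

theorem hasSum_cellIndex_sub_two_mul {E : Type*} [AddCommMonoid E] [TopologicalSpace E]
    {b : ℕ → E} {a : E} (hb : HasSum b a) (m : ℤ) :
    HasSum (fun k : ℤ => b (cellIndex (m - 2 * k))) a :=
  (Equiv.ofBijective _ (bijective_cellIndex_sub_two_mul m)).hasSum_iff.2 hb

/-- The symmetric partial sum over `|k| ≤ K` of the periodization of the cascade filter on the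
interval `(m, m + 1)`. -/
def periodSum (b : ℕ → ℂ) (m : ℤ) (K : ℕ) : ℂ :=
  ∑ k ∈ Finset.Icc (-(K : ℤ)) K, b (cellIndex (m - 2 * k))

theorem sum_Icc_neg_succ {E : Type*} [AddCommGroup E] (u : ℤ → E) (K : ℕ) :
    ∑ k ∈ Finset.Icc (-((K + 1 : ℕ) : ℤ)) (K + 1 : ℕ), u k =
      ∑ k ∈ Finset.Icc (-(K : ℤ)) K, u k + u (K + 1) + u (-K - 1) := by
  have : Finset.Icc (-((K + 1 : ℕ) : ℤ)) (K + 1 : ℕ) =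
      insert (-(K : ℤ) - 1) (insert ((K : ℤ) + 1) (Finset.Icc (-(K : ℤ)) K)) := by
    ext x
    simp only [Finset.mem_Icc, Finset.mem_insert]
    push_cast
    omega
  rw [this, Finset.sum_insert, Finset.sum_insert]
  · abel
  · simp
  · simp only [Finset.mem_insert, Finset.mem_Icc]
    omega

/-- As `k` runs over `|k| ≤ K`, the cell indices `2|k|` and `2|k| - 1` of the intervals
`(-2k, -2k + 1)` exhaust `0, …, 2K`. -/
theorem periodSum_zero (b : ℕ → ℂ) (K : ℕ) :
    periodSum b 0 K = ∑ n ∈ Finset.range (2 * K + 1), b n := by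
  induction K with
  | zero => simp [periodSum, cellIndex]
  | succ K ih =>
    unfold periodSum at ih ⊢
    rw [sum_Icc_neg_succ, ih, show 2 * (K + 1) + 1 = 2 * K + 1 + 1 + 1 by ring,
      Finset.sum_range_succ _ (2 * K + 1 + 1), Finset.sum_range_succ _ (2 * K + 1)]
    congr 3 <;> unfold cellIndex <;> omega

theorem periodSum_reflect (b : ℕ → ℂ) (m : ℤ) (K : ℕ) :
    periodSum b (-1 - m) K = periodSum b m K := by
  unfold periodSum
  refine Finset.sum_nbij' (fun k => -k) (fun k => -k) ?_ ?_ ?_ ?_ ?_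
  · intro k hk; simp only [Finset.mem_Icc] at *; omega
  · intro k hk; simp only [Finset.mem_Icc] at *; omega
  · simp
  · simp
  · intro k _
    rw [← cellIndex_reflect]
    congr 2; ring

/-- Moving the interval by `2` moves the window of summation by one step. -/
theorem periodSum_add_two (b : ℕ → ℂ) (m : ℤ) (K : ℕ) :
    periodSum b (m + 2) K = periodSum b m K + b (cellIndex (m + 2 * K + 2)) -
      b (cellIndex (m - 2 * K)) := by
  have h1 : periodSum b (m + 2) K = ∑ k ∈ Finset.Icc (-(K : ℤ) - 1) (K - 1),
      b (cellIndex (m - 2 * k)) := by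
    unfold periodSum
    refine Finset.sum_nbij' (fun k => k - 1) (fun k => k + 1) ?_ ?_ ?_ ?_ ?_
    · intro k hk; simp only [Finset.mem_Icc] at *; omega
    · intro k hk; simp only [Finset.mem_Icc] at *; omega
    · simp
    · simp
    · intro k _; congr 2; ring
  have h2 : Finset.Icc (-(K : ℤ) - 1) K = insert (K : ℤ) (Finset.Icc (-(K : ℤ) - 1) (K - 1)) := by
    ext x; simp only [Finset.mem_Icc, Finset.mem_insert]; omega
  have h3 : Finset.Icc (-(K : ℤ) - 1) K = insert (-(K : ℤ) - 1) (Finset.Icc (-(K : ℤ)) K) := by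
    ext x; simp only [Finset.mem_Icc, Finset.mem_insert]; omega
  have h4 : ∑ k ∈ Finset.Icc (-(K : ℤ) - 1) K, b (cellIndex (m - 2 * k)) =
      b (cellIndex (m - 2 * K)) + periodSum b (m + 2) K := by
    rw [h1, h2, Finset.sum_insert]; simp
  have h5 : ∑ k ∈ Finset.Icc (-(K : ℤ) - 1) K, b (cellIndex (m - 2 * k)) =
      b (cellIndex (m + 2 * K + 2)) + periodSum b m K := by
    rw [h3, Finset.sum_insert, periodSum]
    · congr 3; ring
    · simp
  have h6 := h4.symm.trans h5
  linear_combination h6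

theorem tendsto_zero_of_tendsto_sum {b : ℕ → ℂ} {a : ℂ}
    (hb : Tendsto (fun N : ℕ => ∑ n ∈ Finset.range N, b n) atTop (𝓝 a)) :
    Tendsto b atTop (𝓝 0) := by
  have h := (hb.comp (tendsto_add_atTop_nat 1)).sub hb
  rw [sub_self] at h
  refine h.congr fun n => ?_
  simp [Finset.sum_range_succ]

/-- The symmetric partial sums of the periodization on `(m, m + 1)` converge to the sum of `b`,
with a bound that grows linearly in `m`: on `(0, 1)` they are partial sums of `b`, and each step of
length `2` away from there exchanges one term for another. -/
theorem periodSum_spec {b : ℕ → ℂ} {a : ℂ} {M B : ℝ}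
    (hb : Tendsto (fun N : ℕ => ∑ n ∈ Finset.range N, b n) atTop (𝓝 a))
    (hM : ∀ N : ℕ, ‖∑ n ∈ Finset.range N, b n‖ ≤ M) (hB : ∀ n, ‖b n‖ ≤ B) (m : ℤ) :
    Tendsto (periodSum b m) atTop (𝓝 a) ∧ ∀ K, ‖periodSum b m K‖ ≤ M + B * (|(m : ℝ)| + 2) := by
  have hb0 := tendsto_zero_of_tendsto_sum hb
  have hB0 : 0 ≤ B := (norm_nonneg _).trans (hB 0)
  -- Induction in steps of `2` from the intervals `(-1, 0)` and `(0, 1)`.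
  have hpos : ∀ j : ℕ, ∀ m : ℤ, (m = 2 * j ∨ m = 2 * j - 1) →
      Tendsto (periodSum b m) atTop (𝓝 a) ∧ ∀ K, ‖periodSum b m K‖ ≤ M + B * (2 * j) := by
    intro j
    induction j with
    | zero =>
      intro m hm
      have h0 : periodSum b m = periodSum b 0 := by
        rcases hm with rfl | rfl
        · simp
        · ext K; exact periodSum_reflect b 0 K
      rw [h0]
      constructor
      · have ht : Tendsto (fun K : ℕ => 2 * K + 1) atTop atTop :=
          tendsto_atTop_mono (fun K => by simp only [id]; omega) tendsto_id
        exact (hb.comp ht).congr fun K => (periodSum_zero b K).symm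
      · intro K; rw [periodSum_zero]; simpa using hM _
    | succ j ih =>
      intro m hm
      obtain ⟨h1, h2⟩ := ih (m - 2) (by push_cast at hm; omega)
      have hrec : ∀ K, periodSum b m K = periodSum b (m - 2) K + b (cellIndex (m - 2 + 2 * K + 2)) -
          b (cellIndex (m - 2 - 2 * K)) := by
        intro K; rw [← periodSum_add_two]; congr 1; ring
      constructor
      · have t1 : Tendsto (fun K : ℕ => cellIndex (m - 2 + 2 * K + 2)) atTop atTop := by
          refine tendsto_atTop_mono' _ ?_ tendsto_id
          filter_upwards [eventually_ge_atTop m.natAbs] with K hK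
          simp only [id, cellIndex]; omega
        have t2 : Tendsto (fun K : ℕ => cellIndex (m - 2 - 2 * K)) atTop atTop := by
          refine tendsto_atTop_mono' _ ?_ tendsto_id
          filter_upwards [eventually_ge_atTop m.natAbs] with K hK
          simp only [id, cellIndex]; omega
        have h := (h1.add (hb0.comp t1)).sub (hb0.comp t2)
        rw [add_zero, sub_zero] at h
        exact h.congr fun K => (hrec K).symm
      · intro K
        rw [hrec]
        refine (norm_sub_le _ _).trans ?_
        have h3 := norm_add_le (periodSum b (m - 2) K) (b (cellIndex (m - 2 + 2 * K + 2)))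
        have h4 := hB (cellIndex (m - 2 + 2 * K + 2))
        have h5 := hB (cellIndex (m - 2 - 2 * K))
        have h6 := h2 K
        push_cast
        linarith
  have key : ∀ m : ℤ, -1 ≤ m → Tendsto (periodSum b m) atTop (𝓝 a) ∧
      ∀ K, ‖periodSum b m K‖ ≤ M + B * (m + 1) := by
    intro m hm
    obtain ⟨h1, h2⟩ := hpos ((m + 1) / 2).toNat m (by omega)
    refine ⟨h1, fun K => (h2 K).trans ?_⟩
    have : ((2 * ((m + 1) / 2).toNat : ℤ) : ℝ) ≤ ((m + 1 : ℤ) : ℝ) := by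
      exact_mod_cast (by omega : (2 * ((m + 1) / 2).toNat : ℤ) ≤ m + 1)
    push_cast at this
    gcongr
  rcases le_or_gt (-1) m with hm | hm
  · obtain ⟨h1, h2⟩ := key m hm
    refine ⟨h1, fun K => (h2 K).trans ?_⟩
    have := le_abs_self (m : ℝ)
    gcongr; linarith
  · obtain ⟨h1, h2⟩ := key (-1 - m) (by omega)
    have h0 : periodSum b (-1 - m) = periodSum b m := funext (periodSum_reflect b m)
    rw [h0] at h1 h2
    refine ⟨h1, fun K => (h2 K).trans ?_⟩
    have := neg_le_abs (m : ℝ)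
    push_cast
    gcongr
    · linarith
    · norm_num

theorem ae_two_pi_mul_ne_int : ∀ᵐ η : ℝ, ∀ i : ℤ, 2 * Real.pi * η ≠ i := by
  rw [ae_all_iff]
  intro i
  filter_upwards [Measure.ae_ne volume ((i : ℝ) / (2 * Real.pi))] with η hη h
  exact hη (by rw [← h]; field_simp)

/-! ### Point values of elements of `V_F` -/

theorem integrable_Lp_haarAddCircle
    (C : Lp ℂ 2 (AddCircle.haarAddCircle (T := (Real.pi⁻¹ : ℝ)))) :
    Integrable (C : FreqCircle → ℂ) :=
  (memLp_haarAddCircle_iff.1 (Lp.memLp C)).integrable one_le_two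

theorem norm_fourier_apply (k : ℤ) (x : FreqCircle) : ‖fourier k x‖ = 1 := by
  rw [fourier_apply]; exact Circle.norm_coe _

theorem integrable_fourier_mul {p : FreqCircle → ℂ} (hp : Integrable p) (k : ℤ) :
    Integrable fun x => fourier k x * p x :=
  hp.bdd_mul (c := 1) (fourier k).continuous.aestronglyMeasurable
    (Eventually.of_forall fun x => (norm_fourier_apply k x).le)

/-- A symmetric interval consists of complete cells and a part of one further cell. -/
theorem Icc_neg_eq_union_freqCell (R : ℝ) :
    Set.Icc (-R) R = (⋃ n ∈ Finset.range ⌊2 * Real.pi * R⌋₊, freqCell n) ∪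
      (freqCell ⌊2 * Real.pi * R⌋₊ ∩ Set.Icc (-R) R) := by
  have hπ := Real.pi_pos
  ext η
  have habs : |2 * Real.pi * η| = 2 * Real.pi * |η| := by
    rw [abs_mul, abs_of_pos (by positivity)]
  have hIcc : η ∈ Set.Icc (-R) R ↔ |η| ≤ R := by rw [Set.mem_Icc, abs_le]
  simp only [Set.mem_union, Set.mem_iUnion, Finset.mem_range, Set.mem_inter_iff, hIcc, freqCell,
    Set.mem_ofPred_eq, exists_prop, exists_eq_right', habs]
  constructor
  · intro h
    have : ⌊2 * Real.pi * |η|⌋₊ ≤ ⌊2 * Real.pi * R⌋₊ := Nat.floor_le_floor (by gcongr)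
    rcases this.lt_or_eq with h1 | h1
    · exact Or.inl h1
    · exact Or.inr ⟨h1, h⟩
  · rintro (h | ⟨_, h⟩)
    · by_contra! hlt
      have : ⌊2 * Real.pi * R⌋₊ ≤ ⌊2 * Real.pi * |η|⌋₊ := Nat.floor_le_floor (by gcongr)
      omega
    · exact h

/-- The Fourier inversion integral at `kπ`, taken over one frequency cell after the other, is the
`k`-th coefficient times a partial sum of `b`; the incomplete last cell contributes `O(b_N)`. -/
theorem hasValueAt_of_fourier_eq {b : lp (fun _ : ℕ => ℂ) 2}
    (hb : Tendsto (fun N : ℕ => ∑ n ∈ Finset.range N, (b : ℕ → ℂ) n) atTop (𝓝 1))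
    {f : Lp ℂ 2 (volume : Measure ℝ)}
    {C : Lp ℂ 2 (AddCircle.haarAddCircle (T := (Real.pi⁻¹ : ℝ)))}
    (hf : (𝓕 f : Lp ℂ 2 (volume : Measure ℝ)) =ᵐ[volume]
        fun η => C (η : FreqCircle) * (𝓕 (sincF b) : Lp ℂ 2 (volume : Measure ℝ)) η) (k : ℤ) :
    HasValueAt f (k * Real.pi) (fourierCoeff C (-k)) := by
  have hπ := Real.pi_pos
  have hπ' : (Real.pi : ℂ) ≠ 0 := by exact_mod_cast Real.pi_ne_zero
  set p : FreqCircle → ℂ := fun x => fourier k x * C x with hp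
  have hpi : Integrable p := integrable_fourier_mul (integrable_Lp_haarAddCircle C) k
  have hv : fourierCoeff C (-k) = Real.pi * ∫ x, p x := by
    rw [fourierCoeff, AddCircle.integral_haarAddCircle, neg_neg, inv_inv, Complex.real_smul]
    rfl
  set F : ℝ → ℂ := fun η => (𝓕 f : Lp ℂ 2 (volume : Measure ℝ)) η *
    Complex.exp (2 * Real.pi * Complex.I * η * ((k * Real.pi : ℝ) : ℂ)) with hF
  have hFp : ∀ᵐ η : ℝ, F η = Real.pi * cascadeFilter b (2 * Real.pi * η) * p η := by
    filter_upwards [hf, fourier_sincF b] with η h1 h2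
    simp only [hF, hp]
    rw [h1, h2, fourier_coe_eq_wave, wave]
    push_cast
    rw [show 2 * (Real.pi : ℂ) * Complex.I * η * (k * Real.pi) =
      2 * Real.pi * (η * (k * Real.pi)) * Complex.I by ring]
    ring
  have hFcell : ∀ n : ℕ, F =ᵐ[volume.restrict (freqCell n)]
      fun η => Real.pi * (b : ℕ → ℂ) n * p η := by
    intro n
    filter_upwards [ae_restrict_of_ae hFp, ae_restrict_mem (measurableSet_freqCell n)] with η h1 h2
    rw [h1, cascadeFilter_of_mem_freqCell _ h2]
  have hFint : ∀ n, IntegrableOn F (freqCell n) := fun n =>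
    (integrable_congr (hFcell n)).2 ((integrableOn_freqCell hpi n).const_mul _)
  have hcell : ∀ n, ∫ η in freqCell n, F η = (b : ℕ → ℂ) n * fourierCoeff C (-k) := by
    intro n
    rw [integral_congr_ae (hFcell n), integral_const_mul, setIntegral_freqCell hpi, hv]
    ring
  have hcellnorm : ∀ n, ∫ η in freqCell n, ‖F η‖ =
      ‖(b : ℕ → ℂ) n‖ * (Real.pi * ∫ x, ‖p x‖) := by
    intro n
    have h : ∀ᵐ η ∂volume.restrict (freqCell n),
        ‖F η‖ = Real.pi * ‖(b : ℕ → ℂ) n‖ * ‖p η‖ := by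
      filter_upwards [hFcell n] with η h
      rw [h, norm_mul, norm_mul, Complex.norm_real, Real.norm_of_nonneg hπ.le]
    rw [integral_congr_ae h, integral_const_mul, setIntegral_freqCell hpi.norm]
    ring
  have hN : Tendsto (fun R : ℝ => ⌊2 * Real.pi * R⌋₊) atTop atTop :=
    tendsto_nat_floor_atTop.comp (tendsto_id.const_mul_atTop (by positivity))
  have hrem : Tendsto (fun R : ℝ =>
      ∫ η in freqCell ⌊2 * Real.pi * R⌋₊ ∩ Set.Icc (-R) R, F η) atTop (𝓝 0) := by
    have h0 : Tendsto (fun R : ℝ => ‖(b : ℕ → ℂ) ⌊2 * Real.pi * R⌋₊‖ *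
        (Real.pi * ∫ x, ‖p x‖)) atTop (𝓝 0) := by
      have := ((tendsto_zero_of_tendsto_sum hb).comp hN).norm.mul_const (Real.pi * ∫ x, ‖p x‖)
      simpa using this
    refine squeeze_zero_norm (fun R => ?_) h0
    rw [← hcellnorm]
    refine (norm_integral_le_integral_norm _).trans ?_
    exact setIntegral_mono_set (hFint _).norm (Eventually.of_forall fun _ => norm_nonneg _)
      (Set.inter_subset_left).eventuallyLE
  have hsum := ((hb.comp hN).mul_const (fourierCoeff C (-k))).add hrem
  rw [one_mul, add_zero] at hsum
  unfold HasValueAt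
  refine hsum.congr' ?_
  filter_upwards [eventually_ge_atTop 0] with R hR
  rw [intervalIntegral.integral_of_le (by linarith), ← integral_Icc_eq_integral_Ioc]
  change _ = ∫ η in Set.Icc (-R) R, F η
  have hsplit := Icc_neg_eq_union_freqCell R
  conv_rhs => rw [hsplit]
  rw [setIntegral_union, integral_biUnion_finset]
  · simp only [Function.comp_apply, hcell, Finset.sum_mul]
  · exact fun n _ => measurableSet_freqCell n
  · exact fun m _ n _ hmn => pairwise_disjoint_freqCell hmn
  · exact fun n _ => hFint n
  · rw [Set.disjoint_left]
    intro η h1 h2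
    simp only [Set.mem_iUnion, Finset.mem_range, exists_prop] at h1
    obtain ⟨n, hn, h3⟩ := h1
    have h4 : _ = _ := h3
    have h5 : _ = _ := h2.1
    omega
  · exact (measurableSet_freqCell _).inter measurableSet_Icc
  · rw [integrableOn_finset_iUnion]
    exact fun n _ => hFint n
  · exact (hFint _).mono_set Set.inter_subset_left

/-! ### The exponential terms on the frequency side -/

theorem measurable_cascadeFilter (b : ℕ → ℂ) : Measurable (cascadeFilter b) := by
  have : cascadeFilter b = fun ξ : ℝ => b ⌊|ξ|⌋₊ := funext (cascadeFilter_eq _)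
  rw [this]
  exact (measurable_from_nat (f := b)).comp (Nat.measurable_floor.comp measurable_norm)

theorem norm_cascadeFilter_le (b : lp (fun _ : ℕ => ℂ) 2) (ξ : ℝ) : ‖cascadeFilter b ξ‖ ≤ ‖b‖ := by
  rw [cascadeFilter_eq]
  exact lp.norm_apply_le_norm two_ne_zero b _

/-- Multiplying the kernel by `e^{2ikx}` shifts one of the two spectra by `k/π`. -/
theorem expTermAt_eq_integral_fourier (b : lp (fun _ : ℕ => ℂ) 2)
    {s u : ℝ → ℂ} (hs : s =ᵐ[volume] sincF b) {f : Lp ℂ 2 (volume : Measure ℝ)}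
    (hu : u =ᵐ[volume] f) (k : ℤ) (t : ℝ) :
    expTermAt s k t u = ∫ η, (𝓕 f : Lp ℂ 2 (volume : Measure ℝ)) (η - k * Real.pi⁻¹) *
      cascadeFilter b (2 * Real.pi * η) * wave (η * t) := by
  have hπ' : (Real.pi : ℂ) ≠ 0 := by exact_mod_cast Real.pi_ne_zero
  have h1 : ∫ x : ℝ, u x * (s (t - x) * Complex.exp (2 * Complex.I * k * x)) =
      ∫ x, f x * (sincF b (t - x) * wave (k * Real.pi⁻¹ * x)) := by
    refine integral_congr_ae ?_
    filter_upwards [hu, (Measure.measurePreserving_sub_left volume t).quasiMeasurePreserving.ae_eq_comp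
      hs] with x hx hy
    simp only [Function.comp_apply] at hy
    rw [hx, hy, wave]
    congr 3
    push_cast
    field_simp
  rw [expTermAt, h1, integral_convolution_modulated, ← integral_const_mul]
  refine integral_congr_ae ?_
  filter_upwards [fourier_sincF b] with η hη
  rw [hη]
  field_simp

/-- For an element of `V_F` the spectral shift can be moved from the element to the filter,
because the periodic factor of its spectrum is invariant under the shift. -/
theorem expTermAt_eq_fourierInv (b : lp (fun _ : ℕ => ℂ) 2)
    {s u : ℝ → ℂ} (hs : s =ᵐ[volume] sincF b) {f : Lp ℂ 2 (volume : Measure ℝ)}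
    (hu : u =ᵐ[volume] f) {C : FreqCircle → ℂ}
    (hf : (𝓕 f : Lp ℂ 2 (volume : Measure ℝ)) =ᵐ[volume]
        fun η => C (η : FreqCircle) * (𝓕 (sincF b) : Lp ℂ 2 (volume : Measure ℝ)) η)
    (k : ℤ) (t : ℝ) :
    expTermAt s k t u = 𝓕⁻ (fun η => (𝓕 f : Lp ℂ 2 (volume : Measure ℝ)) η *
      cascadeFilter b (2 * Real.pi * η - 2 * k)) t := by
  rw [expTermAt_eq_integral_fourier b hs hu, fourierInv_eq_integral_wave]
  have hf' : ∀ᵐ η : ℝ, (𝓕 f : Lp ℂ 2 (volume : Measure ℝ)) η =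
      C (η : FreqCircle) * (Real.pi * cascadeFilter b (2 * Real.pi * η)) := by
    filter_upwards [hf, fourier_sincF b] with η h1 h2
    rw [h1, h2]
  have hf'' := (measurePreserving_sub_right volume (k * Real.pi⁻¹)).quasiMeasurePreserving.ae hf'
  refine integral_congr_ae ?_
  filter_upwards [hf', hf''] with η h1 h2
  have h3 : ((η - k * Real.pi⁻¹ : ℝ) : FreqCircle) = (η : FreqCircle) := by
    rw [AddCircle.coe_sub, ← zsmul_eq_mul, AddCircle.coe_zsmul, AddCircle.coe_period, smul_zero,
      sub_zero]
  have h4 : 2 * Real.pi * (η - k * Real.pi⁻¹) = 2 * Real.pi * η - 2 * k := by field_simp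
  rw [h2, h1, h3, h4]
  ring

theorem integrable_Lp_mul_cascadeFilter_sub (b : lp (fun _ : ℕ => ℂ) 2)
    (f : Lp ℂ 2 (volume : Measure ℝ)) (k : ℤ) :
    Integrable fun η => f η * cascadeFilter b (2 * Real.pi * η - 2 * k) := by
  refine integrable_mul_of_memLp_two (Lp.memLp f) ?_
  have h := memLp_comp_sub_right (memLp_dilate (memLp_cascadeFilter b)) (k * Real.pi⁻¹)
  have e : ∀ η : ℝ, 2 * Real.pi * (η - k * Real.pi⁻¹) = 2 * Real.pi * η - 2 * k := fun η => by
    have := Real.pi_ne_zero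
    field_simp
  simpa only [e] using h

theorem integrable_mul_schwartz_mul_linear {u : ℝ → ℂ} (hu : MemLp u 2 volume) (ψ : 𝓢(ℝ, ℂ))
    (A D : ℝ) : Integrable fun η => ‖u η‖ * ‖ψ η‖ * (A + D * |η|) := by
  have h1 : Integrable fun η => ‖u η * ψ η‖ :=
    (integrable_mul_of_memLp_two hu (ψ.memLp 2 volume)).norm
  have h2 : Integrable fun η => ‖u η * SchwartzMap.smulLeftCLM ℂ (fun x : ℝ => x) ψ η‖ :=
    (integrable_mul_of_memLp_two hu ((SchwartzMap.smulLeftCLM ℂ (fun x : ℝ => x) ψ).memLp 2 volume)).norm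
  refine ((h1.mul_const A).add (h2.mul_const D)).congr (Eventually.of_forall fun η => ?_)
  simp only [Pi.add_apply]
  rw [SchwartzMap.smulLeftCLM_apply_apply (by fun_prop), norm_mul, norm_mul, norm_smul,
    Real.norm_eq_abs]
  ring

/-- The exponential form of the reproducing formula, in the sense of distributions: on the
frequency side the symmetric partial sums of the kernel multiply the spectrum by the partial sums
of the periodization of the filter, which tend to `1`. -/
theorem tendsto_sum_expTerm {b : lp (fun _ : ℕ => ℂ) 2}
    (hb : Tendsto (fun N : ℕ => ∑ n ∈ Finset.range N, (b : ℕ → ℂ) n) atTop (𝓝 1))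
    {f : Lp ℂ 2 (volume : Measure ℝ)} {C : FreqCircle → ℂ}
    (hf : (𝓕 f : Lp ℂ 2 (volume : Measure ℝ)) =ᵐ[volume]
        fun η => C (η : FreqCircle) * (𝓕 (sincF b) : Lp ℂ 2 (volume : Measure ℝ)) η)
    {g : ℝ → ℂ} (hg : g =ᵐ[volume] f) (ψ : 𝓢(ℝ, ℂ)) :
    Tendsto (fun K : ℕ => ∑ k ∈ Finset.Icc (-(K : ℤ)) K,
      expTerm (sincF b) k (fun p => g p.1 * ψ p.2)) atTop (𝓝 (∫ t : ℝ, f t * ψ t)) := by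
  have hπ := Real.pi_pos
  set F : ℝ → ℂ := ⇑(𝓕 f : Lp ℂ 2 (volume : Measure ℝ)) with hF
  have hFm : MemLp F 2 volume := Lp.memLp _
  have hψ : 𝓕⁻ (ψ : ℝ → ℂ) = (𝓕⁻ ψ : 𝓢(ℝ, ℂ)) := (SchwartzMap.fourierInv_coe ψ).symm
  have hterm : ∀ k : ℤ, expTerm (sincF b) k (fun p => g p.1 * ψ p.2) =
      ∫ η, F η * cascadeFilter b (2 * Real.pi * η - 2 * k) * (𝓕⁻ ψ : 𝓢(ℝ, ℂ)) η := by
    intro k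
    rw [← hψ, ← integral_fourierInv_mul_flip (integrable_Lp_mul_cascadeFilter_sub b _ k) ψ.integrable,
      expTerm]
    congr 1; ext t
    rw [← expTermAt_eq_fourierInv b (EventuallyEq.refl _ _) hg hf, expTermAt, expTermAt,
      mul_assoc (Real.pi : ℂ)⁻¹, ← integral_mul_const]
    congr 2; ext x; ring
  have hint : ∀ k : ℤ, Integrable fun η =>
      F η * cascadeFilter b (2 * Real.pi * η - 2 * k) * (𝓕⁻ ψ : 𝓢(ℝ, ℂ)) η := fun k =>
    (integrable_Lp_mul_cascadeFilter_sub b _ k).mul_bdd (𝓕⁻ ψ : 𝓢(ℝ, ℂ)).continuous.aestronglyMeasurable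
      (Eventually.of_forall fun η => SchwartzMap.norm_le_seminorm ℝ (𝓕⁻ ψ : 𝓢(ℝ, ℂ)) η)
  simp_rw [hterm, ← integral_finsetSum _ fun k _ => hint k]
  rw [integral_mul_schwartz, hψ]
  obtain ⟨M, hM⟩ := hb.norm.bddAbove_range
  have hM' : ∀ N : ℕ, ‖∑ n ∈ Finset.range N, (b : ℕ → ℂ) n‖ ≤ M := fun N => hM ⟨N, rfl⟩
  -- `hspec` holds the limit `1` and the bound `M + ‖b‖ (|m| + 2)` for the periodization on
  -- `(m, m + 1)`; with `m = ⌊2πη⌋` the bound is linear in `|η|`.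
  have hspec := periodSum_spec hb hM' fun n => lp.norm_apply_le_norm two_ne_zero b n
  have hper : ∀ᵐ η : ℝ, ∀ K : ℕ, ∑ k ∈ Finset.Icc (-(K : ℤ)) K,
      F η * cascadeFilter b (2 * Real.pi * η - 2 * k) * (𝓕⁻ ψ : 𝓢(ℝ, ℂ)) η =
        F η * (𝓕⁻ ψ : 𝓢(ℝ, ℂ)) η * periodSum b ⌊2 * Real.pi * η⌋ K := by
    filter_upwards [ae_two_pi_mul_ne_int] with η hη K
    rw [periodSum, Finset.mul_sum]
    refine Finset.sum_congr rfl fun k _ => ?_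
    rw [cascadeFilter_sub_two_mul _ hη]; ring
  refine tendsto_integral_of_dominated_convergence
    (fun η => ‖F η‖ * ‖(𝓕⁻ ψ : 𝓢(ℝ, ℂ)) η‖ * ((M + ‖b‖ * 3) + ‖b‖ * (2 * Real.pi) * |η|))
    (fun K => (integrable_finsetSum _ fun k _ => hint k).1)
    (integrable_mul_schwartz_mul_linear hFm _ _ _) (fun K => ?_) ?_
  · filter_upwards [hper] with η hη
    rw [hη, norm_mul, norm_mul]
    gcongr
    refine ((hspec _).2 K).trans ?_
    have h1 : |(⌊2 * Real.pi * η⌋ : ℝ)| ≤ 2 * Real.pi * |η| + 1 := by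
      have h2 := Int.floor_le (2 * Real.pi * η)
      have h3 := Int.lt_floor_add_one (2 * Real.pi * η)
      have h4 : |2 * Real.pi * η| = 2 * Real.pi * |η| := by
        rw [abs_mul, abs_of_pos (by positivity)]
      have h5 := le_abs_self (2 * Real.pi * η)
      have h6 := neg_abs_le (2 * Real.pi * η)
      rw [← h4, abs_le]
      constructor <;> linarith
    have := mul_le_mul_of_nonneg_left h1 (norm_nonneg b)
    linarith
  · filter_upwards [hper] with η hη
    have h := ((hspec ⌊2 * Real.pi * η⌋).1.const_mul (F η * (𝓕⁻ ψ : 𝓢(ℝ, ℂ)) η))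
    rw [mul_one] at h
    exact h.congr fun K => (hη K).symm

/-! ### Poisson summation over `πℤ` -/

theorem summable_of_norm_le_one_add_sq {u : ℤ → ℂ} {D : ℝ}
    (hu : ∀ k : ℤ, ‖u k‖ ≤ D * (1 + (k * Real.pi) ^ 2)⁻¹) : Summable u := by
  have hπ := Real.pi_gt_three
  have h0 : Summable fun k : ℤ => |(k : ℝ)| ^ (-2 : ℝ) := Real.summable_abs_int_rpow one_lt_two
  have hD : 0 ≤ D := by
    have := (norm_nonneg _).trans (hu 0)
    simpa using this
  refine Summable.of_norm_bounded_eventually (h0.mul_left D) ?_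
  rw [Filter.eventually_cofinite]
  refine (Set.finite_singleton (0 : ℤ)).subset fun k hk => ?_
  by_contra hk0
  have hk1 : (k : ℝ) ≠ 0 := by exact_mod_cast hk0
  refine hk ((hu k).trans ?_)
  have h1 : |(k : ℝ)| ^ (-2 : ℝ) = ((k : ℝ) ^ 2)⁻¹ := by
    rw [Real.rpow_neg (abs_nonneg _)]; norm_num
  rw [h1]
  have : 0 < (k : ℝ) ^ 2 := by positivity
  gcongr
  rw [mul_pow]
  have : 1 ≤ Real.pi ^ 2 := by nlinarith
  nlinarith

theorem summable_inv_one_add_sq : Summable fun k : ℤ => (1 + ((k : ℝ) * Real.pi) ^ 2)⁻¹ := by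
  have h := summable_of_norm_le_one_add_sq (D := 1)
    (u := fun k : ℤ => (((1 + ((k : ℝ) * Real.pi) ^ 2)⁻¹ : ℝ) : ℂ)) fun k => by
      rw [Complex.norm_real, Real.norm_of_nonneg (by positivity), one_mul]
  exact_mod_cast h

/-- Poisson summation for the lattice `πℤ`, for a continuous function with quadratic decay and
summable Fourier coefficients. -/
theorem hasSum_poisson {G : ℝ → ℂ} (hG : Continuous G) {D : ℝ}
    (hD : ∀ x, ‖G x‖ ≤ D * (1 + x ^ 2)⁻¹)
    (hs : Summable fun k : ℤ => (Real.pi : ℂ)⁻¹ * ∫ x, G x * Complex.exp (2 * Complex.I * k * x)) :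
    HasSum (fun k : ℤ => (Real.pi : ℂ)⁻¹ * ∫ x, G x * Complex.exp (2 * Complex.I * k * x))
      (∑' k : ℤ, G (k * Real.pi)) := by
  have hπ := Real.pi_pos
  have hF : ∀ k : ℤ, 𝓕 (fun x => G (x * Real.pi)) ((-k : ℤ) : ℝ) =
      (Real.pi : ℂ)⁻¹ * ∫ x, G x * Complex.exp (2 * Complex.I * k * x) := by
    intro k
    rw [fourier_eq_integral_wave]
    have h := Measure.integral_comp_mul_right
      (fun x => G x * Complex.exp (2 * Complex.I * k * x)) Real.pi
    rw [abs_of_pos (by positivity), Complex.real_smul, Complex.ofReal_inv] at h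
    rw [← h]
    congr 1; ext x
    rw [wave]
    congr 2
    push_cast
    ring
  have hs' : Summable fun n : ℤ => 𝓕 (fun x => G (x * Real.pi)) (n : ℝ) := by
    rw [← (Equiv.neg ℤ).summable_iff]
    refine hs.congr fun k => ?_
    rw [← hF]; rfl
  have hO : (fun x => G (x * Real.pi)) =O[cocompact ℝ] fun x : ℝ => |x| ^ (-2 : ℝ) := by
    refine Asymptotics.IsBigO.of_bound D ?_
    have h0 : ∀ᶠ x : ℝ in cocompact ℝ, x ≠ 0 :=
      (isCompact_singleton (x := (0 : ℝ))).compl_mem_cocompact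
    filter_upwards [h0] with x hx
    have hD0 : 0 ≤ D := by simpa using (norm_nonneg _).trans (hD 0)
    refine (hD _).trans ?_
    rw [Real.norm_of_nonneg (by positivity), Real.rpow_neg (abs_nonneg _)]
    have h1 : |x| ^ (2 : ℝ) = x ^ 2 := by norm_num
    rw [h1]
    have : 0 < x ^ 2 := by positivity
    gcongr
    rw [mul_pow]
    have : 1 ≤ Real.pi ^ 2 := by nlinarith [Real.pi_gt_three]
    nlinarith
  have h := Real.tsum_eq_tsum_fourier_of_rpow_decay_of_summable
    (f := fun x => G (x * Real.pi)) (by fun_prop) one_lt_two hO hs' 0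
  simp only [zero_add, QuotientAddGroup.mk_zero, fourier_eval_zero, mul_one] at h
  rw [h]
  have := (Equiv.neg ℤ).hasSum_iff.2 hs'.hasSum
  refine this.congr_fun fun k => ?_
  rw [← hF]; rfl

theorem one_add_sq_mul_norm_le (E : Type*) [NormedAddCommGroup E] [NormedSpace ℝ E]
    (φ : 𝓢(E, ℂ)) (n : ℕ) (x : E) :
    (1 + ‖x‖) ^ n * ‖φ x‖ ≤ 2 ^ n * ((Finset.Iic (n, 0)).sup (schwartzSeminormFamily ℂ E ℂ)) φ := by
  have h := SchwartzMap.one_add_le_sup_seminorm_apply (𝕜 := ℂ) (m := (n, 0)) le_rfl le_rfl φ x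
  rw [norm_iteratedFDeriv_zero] at h
  exact h

/-! ### The kernel as a tempered distribution on the plane -/

/-- The Schwartz seminorm that dominates `(1 + ‖x‖)⁴ ‖φ x‖`, up to the factor `16`. -/
def decaySeminorm : Seminorm ℂ 𝓢(ℝ × ℝ, ℂ) :=
  (Finset.Iic ((4 : ℕ), (0 : ℕ))).sup (schwartzSeminormFamily ℂ (ℝ × ℝ) ℂ)

theorem norm_schwartz_prod_le (χ : 𝓢(ℝ × ℝ, ℂ)) (x u : ℝ) :
    ‖χ (x, u)‖ ≤ 16 * decaySeminorm χ * (1 + x ^ 2)⁻¹ * (1 + u ^ 2)⁻¹ := by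
  have h := one_add_sq_mul_norm_le _ χ 4 (x, u)
  have hx : |x| ≤ ‖(x, u)‖ := norm_fst_le (x, u)
  have hu : |u| ≤ ‖(x, u)‖ := norm_snd_le (x, u)
  have h0 := norm_nonneg (x, u)
  set r := ‖(x, u)‖
  have hx2 : 1 + x ^ 2 ≤ (1 + r) ^ 2 := by
    have : x ^ 2 ≤ r ^ 2 := by rw [← sq_abs]; gcongr
    nlinarith
  have hu2 : 1 + u ^ 2 ≤ (1 + r) ^ 2 := by
    have : u ^ 2 ≤ r ^ 2 := by rw [← sq_abs u]; gcongr
    nlinarith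
  have hm : (1 + x ^ 2) * (1 + u ^ 2) ≤ (1 + r) ^ 4 := by
    calc _ ≤ (1 + r) ^ 2 * (1 + r) ^ 2 := by gcongr
      _ = _ := by ring
  have hpx : 0 < 1 + x ^ 2 := by positivity
  have hpu : 0 < 1 + u ^ 2 := by positivity
  rw [mul_assoc, ← mul_inv, ← div_eq_mul_inv, le_div_iff₀ (by positivity), mul_comm]
  calc _ ≤ (1 + r) ^ 4 * ‖χ (x, u)‖ := by gcongr
    _ ≤ _ := h
    _ = _ := by rw [decaySeminorm]; norm_num

theorem memLp_inv_one_add_sq : MemLp (fun u : ℝ => (1 + u ^ 2)⁻¹) 2 volume := by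
  have hc : Continuous fun u : ℝ => (1 + u ^ 2)⁻¹ :=
    Continuous.inv₀ (by fun_prop) fun u => by positivity
  rw [memLp_two_iff_integrable_sq hc.aestronglyMeasurable]
  refine integrable_inv_one_add_sq.mono' (by fun_prop) (Eventually.of_forall fun u => ?_)
  have h1 : (1 + u ^ 2)⁻¹ ≤ 1 := inv_le_one_of_one_le₀ (by nlinarith)
  have h0 : 0 ≤ (1 + u ^ 2)⁻¹ := by positivity
  rw [Real.norm_of_nonneg (by positivity)]
  nlinarith

theorem integrable_inv_one_add_sq_mul_norm {s : ℝ → ℂ} (hs : MemLp s 2 volume) :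
    Integrable fun u : ℝ => (1 + u ^ 2)⁻¹ * ‖s u‖ :=
  memLp_inv_one_add_sq.integrable_mul hs.norm

theorem integrable_schwartz_prod_mul {s : ℝ → ℂ} (hs : MemLp s 2 volume)
    (χ : 𝓢(ℝ × ℝ, ℂ)) :
    Integrable (fun p : ℝ × ℝ => χ p * s p.2) (volume.prod volume) := by
  have h := (integrable_inv_one_add_sq.mul_prod (integrable_inv_one_add_sq_mul_norm hs)).const_mul
    (16 * decaySeminorm χ)
  refine h.mono' (χ.continuous.aestronglyMeasurable.mul hs.1.comp_snd)
    (Eventually.of_forall fun p => ?_)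
  rw [norm_mul]
  have := norm_schwartz_prod_le χ p.1 p.2
  calc _ ≤ (16 * decaySeminorm χ * (1 + p.1 ^ 2)⁻¹ * (1 + p.2 ^ 2)⁻¹) * ‖s p.2‖ := by gcongr
    _ = _ := by ring

theorem norm_slice_mul_le (s : ℝ → ℂ) (χ : 𝓢(ℝ × ℝ, ℂ)) (x u : ℝ) : ‖χ (x, u) * s u‖ ≤
    16 * decaySeminorm χ * (1 + x ^ 2)⁻¹ * ((1 + u ^ 2)⁻¹ * ‖s u‖) := by
  rw [norm_mul]
  have := norm_schwartz_prod_le χ x u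
  calc _ ≤ (16 * decaySeminorm χ * (1 + x ^ 2)⁻¹ * (1 + u ^ 2)⁻¹) * ‖s u‖ := by gcongr
    _ = _ := by ring

theorem integrable_slice_mul {s : ℝ → ℂ} (hs : MemLp s 2 volume)
    (χ : 𝓢(ℝ × ℝ, ℂ)) (x : ℝ) : Integrable fun u => χ (x, u) * s u :=
  ((integrable_inv_one_add_sq_mul_norm hs).const_mul _).mono'
    ((χ.continuous.comp (by fun_prop : Continuous fun u : ℝ => (x, u))).aestronglyMeasurable.mul
      hs.1) (Eventually.of_forall fun u => norm_slice_mul_le s χ x u)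

theorem norm_integral_slice_mul_le {s : ℝ → ℂ} (hs : MemLp s 2 volume)
    (χ : 𝓢(ℝ × ℝ, ℂ)) (x : ℝ) : ‖∫ u, χ (x, u) * s u‖ ≤
    16 * decaySeminorm χ * (∫ u, (1 + u ^ 2)⁻¹ * ‖s u‖) * (1 + x ^ 2)⁻¹ := by
  refine (norm_integral_le_of_norm_le ((integrable_inv_one_add_sq_mul_norm hs).const_mul _)
    (Eventually.of_forall fun u => norm_slice_mul_le s χ x u)).trans_eq ?_
  rw [integral_const_mul]
  ring

theorem continuous_integral_slice_mul {s : ℝ → ℂ} (hs : MemLp s 2 volume)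
    (χ : 𝓢(ℝ × ℝ, ℂ)) : Continuous fun x => ∫ u, χ (x, u) * s u := by
  refine continuous_of_dominated
    (bound := fun u => 16 * decaySeminorm χ * ((1 + u ^ 2)⁻¹ * ‖s u‖))
    (fun x => (integrable_slice_mul hs χ x).1) (fun x => Eventually.of_forall fun u => ?_)
    ((integrable_inv_one_add_sq_mul_norm hs).const_mul _) (Eventually.of_forall fun u => ?_)
  · refine (norm_slice_mul_le s χ x u).trans ?_
    have h1 : (1 + x ^ 2)⁻¹ ≤ 1 := inv_le_one_of_one_le₀ (by nlinarith)
    have h2 : 0 ≤ decaySeminorm χ := apply_nonneg _ _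
    have h3 : 16 * decaySeminorm χ * (1 + x ^ 2)⁻¹ ≤ 16 * decaySeminorm χ :=
      mul_le_of_le_one_right (by positivity) h1
    gcongr
  · exact (χ.continuous.comp (by fun_prop : Continuous fun x : ℝ => (x, u))).mul continuous_const

theorem integrable_schwartz_prod_mul_exp {s : ℝ → ℂ} (hs : MemLp s 2 volume)
    (χ : 𝓢(ℝ × ℝ, ℂ)) (k : ℤ) :
    Integrable (fun p : ℝ × ℝ => χ p * s p.2 * Complex.exp (2 * Complex.I * k * p.1))
      (volume.prod volume) := by
  refine (integrable_schwartz_prod_mul hs χ).mul_bdd (c := 1)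
    (Continuous.aestronglyMeasurable (by fun_prop)) (Eventually.of_forall fun p => ?_)
  rw [show 2 * Complex.I * k * (p.1 : ℂ) = ((2 * k * p.1 : ℝ) : ℂ) * Complex.I by push_cast; ring,
    Complex.norm_exp_ofReal_mul_I]

theorem integral_integral_slice_mul_exp {s : ℝ → ℂ} (hs : MemLp s 2 volume)
    (χ : 𝓢(ℝ × ℝ, ℂ)) (k : ℤ) :
    ∫ x, (∫ u, χ (x, u) * s u) * Complex.exp (2 * Complex.I * k * x) =
      ∫ u, (∫ x, χ (x, u) * Complex.exp (2 * Complex.I * k * x)) * s u := by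
  have h := integral_integral_swap (f := fun x u : ℝ =>
    χ (x, u) * s u * Complex.exp (2 * Complex.I * k * x)) (integrable_schwartz_prod_mul_exp hs χ k)
  simp_rw [← integral_mul_const]
  rw [h]
  congr 1; ext u; congr 1; ext x; ring

theorem norm_integral_integral_slice_mul_exp_le {s : ℝ → ℂ} (hs : MemLp s 2 volume)
    (χ : 𝓢(ℝ × ℝ, ℂ)) (k : ℤ) :
    ‖∫ x, (∫ u, χ (x, u) * s u) * Complex.exp (2 * Complex.I * k * x)‖ ≤
      16 * decaySeminorm χ * (∫ u, (1 + u ^ 2)⁻¹ * ‖s u‖) * ∫ x : ℝ, (1 + x ^ 2)⁻¹ := by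
  rw [← integral_const_mul]
  refine norm_integral_le_of_norm_le (integrable_inv_one_add_sq.const_mul _)
    (Eventually.of_forall fun x => ?_)
  rw [norm_mul, show 2 * Complex.I * k * (x : ℂ) = ((2 * k * x : ℝ) : ℂ) * Complex.I by
    push_cast; ring, Complex.norm_exp_ofReal_mul_I, mul_one]
  exact norm_integral_slice_mul_le hs χ x

theorem integrable_slice_fst (χ : 𝓢(ℝ × ℝ, ℂ)) (u : ℝ) : Integrable fun x => χ (x, u) := by
  refine (integrable_inv_one_add_sq.const_mul (16 * decaySeminorm χ * (1 + u ^ 2)⁻¹)).mono'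
    (χ.continuous.comp (by fun_prop : Continuous fun x : ℝ => (x, u))).aestronglyMeasurable
    (Eventually.of_forall fun x => (norm_schwartz_prod_le χ x u).trans_eq ?_)
  ring

/-- Integration by parts: differentiating in the first variable multiplies the Fourier
coefficients in that variable by `-2ik`. -/
theorem integral_lineDeriv_slice_mul_exp (χ : 𝓢(ℝ × ℝ, ℂ)) (u : ℝ) (k : ℤ) :
    ∫ x, (LineDeriv.lineDerivOp ((1, 0) : ℝ × ℝ) χ) (x, u) * Complex.exp (2 * Complex.I * k * x) =
      -(2 * Complex.I * k) * ∫ x, χ (x, u) * Complex.exp (2 * Complex.I * k * x) := by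
  have hπ' : (Real.pi : ℂ) ≠ 0 := by exact_mod_cast Real.pi_ne_zero
  have hd : ∀ x, HasDerivAt (fun x => χ (x, u))
      ((LineDeriv.lineDerivOp ((1, 0) : ℝ × ℝ) χ) (x, u)) x := by
    intro x
    rw [SchwartzMap.lineDerivOp_apply_eq_fderiv]
    have h1 : HasDerivAt (fun x : ℝ => (x, u)) ((1, 0) : ℝ × ℝ) x :=
      (hasDerivAt_id x).prodMk (hasDerivAt_const x u)
    exact (χ.hasFDerivAt (x, u)).comp_hasDerivAt x h1
  have hderiv : deriv (fun x => χ (x, u)) =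
      fun x => (LineDeriv.lineDerivOp ((1, 0) : ℝ × ℝ) χ) (x, u) := funext fun x => (hd x).deriv
  have h := Real.fourier_deriv (integrable_slice_fst χ u) (fun x => (hd x).differentiableAt)
    (by rw [hderiv]; exact integrable_slice_fst _ u)
  have hF : ∀ v : ℝ → ℂ, 𝓕 v (-(k * Real.pi⁻¹)) =
      ∫ x, v x * Complex.exp (2 * Complex.I * k * x) := by
    intro v
    rw [fourier_eq_integral_wave]
    congr 1; ext x
    rw [wave]
    congr 2
    push_cast
    field_simp
  have h2 := congrFun h (-(k * Real.pi⁻¹))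
  rw [hderiv, hF, hF, smul_eq_mul] at h2
  rw [h2]
  congr 1
  push_cast
  field_simp

/-- The Fourier coefficients of the partial pairing of a Schwartz function with an `L²` function
decay quadratically. -/
theorem exists_norm_integral_slice_mul_exp_le {s : ℝ → ℂ} (hs : MemLp s 2 volume)
    (χ : 𝓢(ℝ × ℝ, ℂ)) : ∃ D, ∀ k : ℤ,
    ‖(Real.pi : ℂ)⁻¹ * ∫ x, (∫ u, χ (x, u) * s u) * Complex.exp (2 * Complex.I * k * x)‖ ≤
      D * (1 + (k * Real.pi) ^ 2)⁻¹ := by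
  set c : 𝓢(ℝ × ℝ, ℂ) → ℤ → ℂ := fun χ k =>
    ∫ x, (∫ u, χ (x, u) * s u) * Complex.exp (2 * Complex.I * k * x) with hc
  have hrec : ∀ χ k, c (LineDeriv.lineDerivOp ((1, 0) : ℝ × ℝ) χ) k =
      -(2 * Complex.I * k) * c χ k := by
    intro χ k
    simp only [hc]
    rw [integral_integral_slice_mul_exp hs, integral_integral_slice_mul_exp hs,
      ← integral_const_mul]
    congr 1; ext u
    rw [integral_lineDeriv_slice_mul_exp]; ring
  -- Two integrations by parts relate the coefficients of `χ` to those of `∂ₓ² χ`.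
  set χ' := LineDeriv.lineDerivOp ((1, 0) : ℝ × ℝ) (LineDeriv.lineDerivOp ((1, 0) : ℝ × ℝ) χ)
  obtain ⟨A, hA⟩ : ∃ A, ∀ k, ‖c χ k‖ ≤ A := ⟨_, norm_integral_integral_slice_mul_exp_le hs χ⟩
  obtain ⟨A', hA'⟩ : ∃ A, ∀ k, ‖c χ' k‖ ≤ A := ⟨_, norm_integral_integral_slice_mul_exp_le hs χ'⟩
  refine ⟨Real.pi⁻¹ * (A + A' * Real.pi ^ 2 / 4), fun k => ?_⟩
  have h1 : 4 * (k : ℝ) ^ 2 * ‖c χ k‖ = ‖c χ' k‖ := by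
    rw [hrec, hrec, norm_mul, norm_mul]
    simp only [norm_neg, norm_mul, Complex.norm_I, Complex.norm_intCast, Complex.norm_ofNat]
    rw [← sq_abs]; ring
  rw [← div_eq_mul_inv, le_div_iff₀ (by positivity), norm_mul, norm_inv, Complex.norm_real,
    Real.norm_of_nonneg Real.pi_pos.le, mul_assoc]
  gcongr
  change ‖c χ k‖ * _ ≤ _
  have h2 := hA' k
  rw [← h1] at h2
  have h3 := mul_le_mul_of_nonneg_right h2 (by positivity : (0 : ℝ) ≤ Real.pi ^ 2 / 4)
  have h4 := hA k
  nlinarith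

/-- The shear `(x, u) ↦ (x, x + u)` of the plane. -/
def shear : (ℝ × ℝ) ≃L[ℝ] ℝ × ℝ :=
  (ContinuousLinearEquiv.refl ℝ ℝ).skewProd (ContinuousLinearEquiv.refl ℝ ℝ)
    (ContinuousLinearMap.id ℝ ℝ)

/-- Precomposition of Schwartz functions with the shear. -/
def shearCLM : 𝓢(ℝ × ℝ, ℂ) →L[ℂ] 𝓢(ℝ × ℝ, ℂ) :=
  SchwartzMap.compCLMOfContinuousLinearEquiv ℂ shear

theorem shearCLM_apply (φ : 𝓢(ℝ × ℝ, ℂ)) (x u : ℝ) : shearCLM φ (x, u) = φ (x, x + u) := by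
  rw [shearCLM, SchwartzMap.compCLMOfContinuousLinearEquiv_apply, Function.comp_apply]
  congr 1
  simp [shear, add_comm]

theorem deltaTerm_eq_integral_slice (s : ℝ → ℂ) (φ : 𝓢(ℝ × ℝ, ℂ)) (k : ℤ) :
    deltaTerm s k φ = ∫ u, shearCLM φ (k * Real.pi, u) * s u := by
  simp only [deltaTerm, deltaTermAt, shearCLM_apply]
  symm
  rw [← integral_sub_right_eq_self _ ((k : ℝ) * Real.pi)]
  congr 1; ext t
  rw [add_sub_cancel]

theorem expTerm_eq_integral_slice {s : ℝ → ℂ} (hs : MemLp s 2 volume) (φ : 𝓢(ℝ × ℝ, ℂ)) (k : ℤ) :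
    expTerm s k φ = (Real.pi : ℂ)⁻¹ *
      ∫ x, (∫ u, shearCLM φ (x, u) * s u) * Complex.exp (2 * Complex.I * k * x) := by
  have h1 : Integrable (fun p : ℝ × ℝ =>
      φ p * (s (p.2 - p.1) * Complex.exp (2 * Complex.I * k * p.1))) (volume.prod volume) := by
    have hmp := measurePreserving_prod_add (volume : Measure ℝ) (volume : Measure ℝ)
    have hemb : MeasurableEmbedding (fun z : ℝ × ℝ => (z.1, z.1 + z.2)) :=
      (MeasurableEquiv.shearAddRight ℝ).measurableEmbedding
    rw [← hmp.integrable_comp_emb hemb]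
    refine (integrable_schwartz_prod_mul_exp hs (shearCLM φ) k).congr
      (Eventually.of_forall fun p => ?_)
    simp only [Function.comp_apply, add_sub_cancel_left]
    rw [← Prod.mk.eta (p := p), shearCLM_apply]
    ring
  have h2 := integral_integral_swap (f := fun x t : ℝ =>
      φ (x, t) * (s (t - x) * Complex.exp (2 * Complex.I * k * x))) h1
  simp only [expTerm, expTermAt]
  rw [integral_const_mul, ← h2]
  congr 2; ext x
  symm
  rw [← integral_mul_const, ← integral_sub_right_eq_self _ x]
  congr 1; ext t
  rw [shearCLM_apply, add_sub_cancel]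
  ring

/-- Pairing a Schwartz function on the plane with an `L²` function in the second variable and
summing over `πℤ` in the first is a continuous functional. -/
theorem exists_lattice_functional {s : ℝ → ℂ} (hs : MemLp s 2 volume) :
    ∃ Ψ : 𝓢(ℝ × ℝ, ℂ) →L[ℂ] ℂ, ∀ χ : 𝓢(ℝ × ℝ, ℂ),
      HasSum (fun k : ℤ => ∫ u, χ (k * Real.pi, u) * s u) (Ψ χ) := by
  set W := ∫ u, (1 + u ^ 2)⁻¹ * ‖s u‖ with hW
  have hW0 : 0 ≤ W := integral_nonneg fun u => by positivity
  have hle : ∀ (χ : 𝓢(ℝ × ℝ, ℂ)) (k : ℤ), ‖∫ u, χ (k * Real.pi, u) * s u‖ ≤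
      16 * decaySeminorm χ * W * (1 + (k * Real.pi) ^ 2)⁻¹ := fun χ k =>
    norm_integral_slice_mul_le hs χ (k * Real.pi)
  have hsum : ∀ χ : 𝓢(ℝ × ℝ, ℂ), Summable fun k : ℤ => ∫ u, χ (k * Real.pi, u) * s u := fun χ =>
    summable_of_norm_le_one_add_sq (hle χ)
  refine ⟨SchwartzMap.mkCLMtoNormedSpace (fun χ => ∑' k : ℤ, ∫ u, χ (k * Real.pi, u) * s u)
    (fun χ χ' => ?_) (fun a χ => ?_) ⟨Finset.Iic (4, 0),
      16 * W * ∑' k : ℤ, (1 + ((k : ℝ) * Real.pi) ^ 2)⁻¹, ?_, fun χ => ?_⟩, fun χ =>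
        (hsum χ).hasSum⟩
  · rw [← (hsum χ).tsum_add (hsum χ')]
    congr 1; ext k
    rw [← integral_add (integrable_slice_mul hs χ _) (integrable_slice_mul hs χ' _)]
    congr 1; ext u
    rw [add_apply, add_mul]
  · rw [RingHom.id_apply, smul_eq_mul, ← tsum_mul_left]
    congr 1; ext k
    rw [← integral_const_mul]
    congr 1; ext u
    rw [smul_apply, smul_eq_mul, mul_assoc]
  · have : 0 ≤ ∑' k : ℤ, (1 + ((k : ℝ) * Real.pi) ^ 2)⁻¹ := tsum_nonneg fun k => by positivity
    positivity
  · refine (tsum_of_norm_bounded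
      (summable_inv_one_add_sq.mul_left (16 * decaySeminorm χ * W)).hasSum (hle χ)).trans_eq ?_
    rw [tsum_mul_left, decaySeminorm]
    ring

/-- The two series for the kernel built from an `L²` function converge to one tempered distribution
on the plane: in the sheared variables the delta series is a lattice sum, and Poisson summation
turns it into the exponential series. -/
theorem exists_kernel_distribution {s : ℝ → ℂ} (hs : MemLp s 2 volume) :
    ∃ Φ : 𝓢'(ℝ × ℝ, ℂ), ∀ φ : 𝓢(ℝ × ℝ, ℂ),
      HasSum (fun k : ℤ => expTerm s k φ) (Φ φ) ∧ HasSum (fun k : ℤ => deltaTerm s k φ) (Φ φ) := by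
  obtain ⟨Ψ, hΨ⟩ := exists_lattice_functional hs
  refine ⟨ContinuousLinearMap.toPointwiseConvergenceCLM _ _ _ _ (Ψ.comp shearCLM), fun φ => ?_⟩
  have h1 := hΨ (shearCLM φ)
  constructor
  · simp_rw [expTerm_eq_integral_slice hs]
    obtain ⟨D, hD⟩ := exists_norm_integral_slice_mul_exp_le hs (shearCLM φ)
    have h2 := hasSum_poisson (continuous_integral_slice_mul hs (shearCLM φ))
      (norm_integral_slice_mul_le hs (shearCLM φ)) (summable_of_norm_le_one_add_sq hD)
    rw [h1.tsum_eq] at h2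
    exact h2
  · simp_rw [deltaTerm_eq_integral_slice]
    exact h1

/-! ### Absolutely summable coefficients -/

theorem integrableOn_mul_cascadeFilter_freqCell (b : ℕ → ℂ) {p : FreqCircle → ℂ}
    (hp : Integrable p) (n : ℕ) :
    IntegrableOn (fun η : ℝ => p η * cascadeFilter b (2 * Real.pi * η)) (freqCell n) := by
  refine ((integrableOn_freqCell hp n).mul_const (b n)).congr ?_
  filter_upwards [ae_restrict_mem (measurableSet_freqCell n)] with η hη
  rw [cascadeFilter_of_mem_freqCell b hη]

theorem setIntegral_norm_mul_cascadeFilter (b : ℕ → ℂ) {p : FreqCircle → ℂ}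
    (hp : Integrable p) (n : ℕ) :
    ∫ η in freqCell n, ‖p η * cascadeFilter b (2 * Real.pi * η)‖ = ‖b n‖ * ∫ x, ‖p x‖ := by
  rw [← setIntegral_freqCell hp.norm n, ← integral_const_mul]
  refine setIntegral_congr_fun (measurableSet_freqCell n) fun η hη => ?_
  rw [cascadeFilter_of_mem_freqCell b hη, norm_mul, mul_comm]

/-- For `b ∈ ℓ¹` multiplication by the filter maps integrable functions on the circle to
integrable functions on the line. -/
theorem integrable_periodic_mul_cascadeFilter {b : ℕ → ℂ} (hb : Summable fun n => ‖b n‖)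
    {p : FreqCircle → ℂ} (hp : Integrable p) :
    Integrable fun η : ℝ => p η * cascadeFilter b (2 * Real.pi * η) := by
  rw [← integrableOn_univ, ← iUnion_freqCell]
  refine integrableOn_iUnion_of_summable_integral_norm
    (integrableOn_mul_cascadeFilter_freqCell b hp) ?_
  simp_rw [setIntegral_norm_mul_cascadeFilter b hp]
  exact hb.mul_right _

theorem integral_norm_mul_cascadeFilter {b : ℕ → ℂ} (hb : Summable fun n => ‖b n‖)
    {p : FreqCircle → ℂ} (hp : Integrable p) :
    ∫ η : ℝ, ‖p η * cascadeFilter b (2 * Real.pi * η)‖ = (∑' n, ‖b n‖) * ∫ x, ‖p x‖ := by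
  rw [← setIntegral_univ, ← iUnion_freqCell, integral_iUnion measurableSet_freqCell
    pairwise_disjoint_freqCell (by
      rw [iUnion_freqCell, integrableOn_univ]; exact (integrable_periodic_mul_cascadeFilter hb hp).norm)]
  simp_rw [setIntegral_norm_mul_cascadeFilter b hp, tsum_mul_right]

theorem integrable_cascadeFilter {b : ℕ → ℂ} (hb : Summable fun n => ‖b n‖) :
    Integrable fun η : ℝ => cascadeFilter b (2 * Real.pi * η) := by
  simpa using integrable_periodic_mul_cascadeFilter hb (integrable_const (μ := volume) (1 : ℂ))

theorem integrable_mul_cascadeFilter_sub (b : lp (fun _ : ℕ => ℂ) 2) {h : ℝ → ℂ}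
    (hh : Integrable h) (k : ℤ) :
    Integrable fun η => h η * cascadeFilter b (2 * Real.pi * η - 2 * k) :=
  hh.mul_bdd ((measurable_cascadeFilter b).comp (by fun_prop)).aestronglyMeasurable
    (Eventually.of_forall fun _ => norm_cascadeFilter_le b _)

/-- The `L¹` norms are summable because the translates of `|H|` add up to the constant `‖b‖₁`. -/
theorem summable_integral_norm_mul_cascadeFilter_sub {b : lp (fun _ : ℕ => ℂ) 2}
    (hb : Summable fun n => ‖(b : ℕ → ℂ) n‖) {h : ℝ → ℂ} (hh : Integrable h) :
    Summable fun k : ℤ => ∫ η, ‖h η * cascadeFilter b (2 * Real.pi * η - 2 * k)‖ := by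
  refine summable_of_sum_le (c := ∫ η, ‖h η‖ * ∑' n, ‖(b : ℕ → ℂ) n‖)
    (fun k => integral_nonneg fun _ => norm_nonneg _) fun u => ?_
  rw [← integral_finsetSum _ fun k _ => (integrable_mul_cascadeFilter_sub b hh k).norm]
  refine integral_mono_ae (integrable_finsetSum _ fun k _ =>
    (integrable_mul_cascadeFilter_sub b hh k).norm) (hh.norm.mul_const _) ?_
  filter_upwards [ae_two_pi_mul_ne_int] with η hη
  simp_rw [norm_mul, ← Finset.mul_sum, cascadeFilter_sub_two_mul _ hη]
  gcongr
  exact sum_le_hasSum _ (fun _ _ => norm_nonneg _) (hasSum_cellIndex_sub_two_mul hb.hasSum _)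

/-- For `b ∈ ℓ¹` the integer translates of the filter sum unconditionally to the sum of `b`. -/
theorem hasSum_integral_mul_cascadeFilter_sub {b : lp (fun _ : ℕ => ℂ) 2}
    (hb : Summable fun n => ‖(b : ℕ → ℂ) n‖) {a : ℂ} (ha : HasSum (b : ℕ → ℂ) a)
    {h : ℝ → ℂ} (hh : Integrable h) :
    HasSum (fun k : ℤ => ∫ η, h η * cascadeFilter b (2 * Real.pi * η - 2 * k))
      (∫ η, h η * a) := by
  have h1 := hasSum_integral_of_summable_integral_norm (F := fun (k : ℤ) (η : ℝ) =>
    h η * cascadeFilter b (2 * Real.pi * η - 2 * k)) (integrable_mul_cascadeFilter_sub b hh)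
    (summable_integral_norm_mul_cascadeFilter_sub hb hh)
  suffices h2 : ∫ η, h η * a = ∫ η, ∑' k : ℤ, h η * cascadeFilter b (2 * Real.pi * η - 2 * k) by
    rwa [h2]
  refine integral_congr_ae ?_
  filter_upwards [ae_two_pi_mul_ne_int] with η hη
  simp_rw [cascadeFilter_sub_two_mul _ hη]
  exact ((hasSum_cellIndex_sub_two_mul ha _).mul_left (h η)).tsum_eq.symm

/-- The continuous representative `t ↦ π ∫ H(2πη) e^{2πiηt} dη` of the generalized sinc function
for `b ∈ ℓ¹`. -/
def sincRep (b : ℕ → ℂ) (t : ℝ) : ℂ := Real.pi * 𝓕⁻ (fun η => cascadeFilter b (2 * Real.pi * η)) t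

theorem continuous_sincRep {b : ℕ → ℂ} (hb : Summable fun n => ‖b n‖) : Continuous (sincRep b) := by
  have h := continuous_fourierInv (integrable_cascadeFilter hb)
  exact continuous_const.mul h

theorem sincRep_ae_eq {b : lp (fun _ : ℕ => ℂ) 2} (hb : Summable fun n => ‖(b : ℕ → ℂ) n‖) :
    sincRep b =ᵐ[volume] sincF b := by
  rw [sincF_eq_smul_fourierInv]
  filter_upwards [fourierInv_toLp_ae_eq (integrable_cascadeFilter hb)
    (memLp_dilate (memLp_cascadeFilter b)), Lp.coeFn_smul (Real.pi : ℂ)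
    (𝓕⁻ ((memLp_dilate (memLp_cascadeFilter b)).toLp _) : Lp ℂ 2 (volume : Measure ℝ))]
    with t h1 h2
  rw [h2, Pi.smul_apply, h1, smul_eq_mul, sincRep]

theorem norm_fourierInv_le {h : ℝ → ℂ} (t : ℝ) : ‖𝓕⁻ h t‖ ≤ ∫ η, ‖h η‖ := by
  rw [fourierInv_eq_integral_wave]
  refine (norm_integral_le_integral_norm _).trans_eq ?_
  simp

theorem exists_norm_sincRep_le (b : ℕ → ℂ) : ∃ S, ∀ t, ‖sincRep b t‖ ≤ S := by
  refine ⟨Real.pi * ∫ η, ‖cascadeFilter b (2 * Real.pi * η)‖, fun t => ?_⟩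
  rw [sincRep, norm_mul, Complex.norm_real, Real.norm_of_nonneg Real.pi_pos.le]
  gcongr
  exact norm_fourierInv_le t

theorem norm_schwartz_le (φ : 𝓢(ℝ, ℂ)) (x : ℝ) : ‖φ x‖ ≤
    4 * ((Finset.Iic ((2 : ℕ), (0 : ℕ))).sup (schwartzSeminormFamily ℂ ℝ ℂ)) φ *
      (1 + x ^ 2)⁻¹ := by
  have h := one_add_sq_mul_norm_le _ φ 2 x
  rw [← div_eq_mul_inv, le_div_iff₀ (by positivity), mul_comm]
  have h0 : 1 + x ^ 2 ≤ (1 + ‖x‖) ^ 2 := by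
    rw [Real.norm_eq_abs, add_sq, sq_abs]; have := abs_nonneg x; linarith
  calc _ ≤ (1 + ‖x‖) ^ 2 * ‖φ x‖ := by gcongr
    _ ≤ _ := h
    _ = _ := by norm_num

/-- The samples of a Schwartz function on `πℤ`, with bounded weights, define a tempered
distribution. -/
theorem exists_weighted_comb (w : ℤ → ℂ) {S : ℝ} (hw : ∀ k, ‖w k‖ ≤ S) :
    ∃ Ψ : 𝓢(ℝ, ℂ) →L[ℂ] ℂ, ∀ φ : 𝓢(ℝ, ℂ),
      HasSum (fun k : ℤ => φ (k * Real.pi) * w k) (Ψ φ) := by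
  have hS0 : 0 ≤ S := (norm_nonneg _).trans (hw 0)
  set q := (Finset.Iic ((2 : ℕ), (0 : ℕ))).sup (schwartzSeminormFamily ℂ ℝ ℂ) with hq
  have hle : ∀ (φ : 𝓢(ℝ, ℂ)) (k : ℤ), ‖φ (k * Real.pi) * w k‖ ≤
      4 * q φ * S * (1 + (k * Real.pi) ^ 2)⁻¹ := by
    intro φ k
    rw [norm_mul]
    calc _ ≤ (4 * q φ * (1 + (k * Real.pi) ^ 2)⁻¹) * S := by
          gcongr
          · exact norm_schwartz_le φ _
          · exact hw k
      _ = _ := by ring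
  have hsum : ∀ φ : 𝓢(ℝ, ℂ), Summable fun k : ℤ => φ (k * Real.pi) * w k := fun φ =>
    summable_of_norm_le_one_add_sq (hle φ)
  refine ⟨SchwartzMap.mkCLMtoNormedSpace (fun φ => ∑' k : ℤ, φ (k * Real.pi) * w k)
    (fun φ φ' => ?_) (fun a φ => ?_) ⟨Finset.Iic (2, 0),
      4 * S * ∑' k : ℤ, (1 + ((k : ℝ) * Real.pi) ^ 2)⁻¹, ?_, fun φ => ?_⟩, fun φ =>
        (hsum φ).hasSum⟩
  · rw [← (hsum φ).tsum_add (hsum φ')]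
    congr 1; ext k
    rw [add_apply, add_mul]
  · rw [RingHom.id_apply, smul_eq_mul, ← tsum_mul_left]
    congr 1; ext k
    rw [smul_apply, smul_eq_mul, mul_assoc]
  · have : 0 ≤ ∑' k : ℤ, (1 + ((k : ℝ) * Real.pi) ^ 2)⁻¹ := tsum_nonneg fun k => by positivity
    positivity
  · refine (tsum_of_norm_bounded
      (summable_inv_one_add_sq.mul_left (4 * q φ * S)).hasSum (hle φ)).trans_eq ?_
    rw [tsum_mul_left]
    ring

/-- For `b ∈ ℓ¹` and fixed `t` the two series for the kernel converge to one tempered distribution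
in `x`. The exponential series is dominated by the integrals of the translates of the filter
against the spectrum of the test function, so Poisson summation applies. -/
theorem exists_kernel_distribution_at {b : lp (fun _ : ℕ => ℂ) 2}
    (hb : Summable fun n => ‖(b : ℕ → ℂ) n‖) (t : ℝ) :
    ∃ Φt : 𝓢'(ℝ, ℂ), ∀ φ : 𝓢(ℝ, ℂ),
      HasSum (fun k : ℤ => expTermAt (sincRep b) k t φ) (Φt φ) ∧
      HasSum (fun k : ℤ => deltaTermAt (sincRep b) k t φ) (Φt φ) := by
  obtain ⟨S, hS⟩ := exists_norm_sincRep_le b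
  have hS0 : 0 ≤ S := (norm_nonneg _).trans (hS 0)
  obtain ⟨Ψ, hΨ⟩ := exists_weighted_comb (fun k : ℤ => sincRep b (t - k * Real.pi)) fun k => hS _
  refine ⟨ContinuousLinearMap.toPointwiseConvergenceCLM _ _ _ _ Ψ, fun φ => ⟨?_, hΨ φ⟩⟩
  have hterm : ∀ k : ℤ, expTermAt (sincRep b) k t φ = (Real.pi : ℂ)⁻¹ *
      ∫ x, (φ x * sincRep b (t - x)) * Complex.exp (2 * Complex.I * k * x) := by
    intro k
    simp only [expTermAt, mul_assoc]
  have hsum : Summable fun k : ℤ => expTermAt (sincRep b) k t φ := by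
    have h1 := summable_integral_norm_mul_cascadeFilter_sub hb (𝓕 φ).integrable
    rw [← (Equiv.neg ℤ).summable_iff] at h1
    refine Summable.of_norm_bounded h1 fun k => ?_
    rw [expTermAt_eq_integral_fourier b (sincRep_ae_eq hb) (φ.coeFn_toLp 2 volume).symm,
      SchwartzMap.toLp_fourier_eq]
    refine (norm_integral_le_integral_norm _).trans_eq ?_
    rw [← integral_add_right_eq_self _ (k * Real.pi⁻¹)]
    refine integral_congr_ae ?_
    filter_upwards [(𝓕 φ).coeFn_toLp 2 volume] with η hη
    rw [add_sub_cancel_right, hη, norm_mul, norm_wave, mul_one]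
    congr 3
    simp only [Equiv.neg_apply]
    have := Real.pi_ne_zero
    push_cast
    field_simp
    ring
  have hD : ∀ x, ‖φ x * sincRep b (t - x)‖ ≤
      4 * ((Finset.Iic ((2 : ℕ), (0 : ℕ))).sup (schwartzSeminormFamily ℂ ℝ ℂ)) φ * S *
        (1 + x ^ 2)⁻¹ := by
    intro x
    rw [norm_mul, mul_right_comm]
    gcongr
    · exact norm_schwartz_le φ x
    · exact hS _
  have h2 := hasSum_poisson (G := fun x => φ x * sincRep b (t - x))
    (φ.continuous.mul ((continuous_sincRep hb).comp (by fun_prop))) hD (hsum.congr hterm)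
  rw [(hΨ φ).tsum_eq] at h2
  exact h2.congr_fun fun k => hterm k

theorem integral_norm_haarAddCircle_le
    (D : Lp ℂ 2 (AddCircle.haarAddCircle (T := (Real.pi⁻¹ : ℝ)))) :
    ∫ x, ‖D x‖ ∂AddCircle.haarAddCircle ≤ ‖D‖ := by
  rw [integral_norm_eq_lintegral_enorm (Lp.aestronglyMeasurable D), ← eLpNorm_one_eq_lintegral_enorm,
    Lp.norm_def]
  exact ENNReal.toReal_mono (Lp.eLpNorm_ne_top D)
    (eLpNorm_le_eLpNorm_of_exponent_le one_le_two (Lp.aestronglyMeasurable D))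

/-- The pairing of a function on the circle with `π H(2πη) e^{2πiηt}` over the line is a bounded
functional on `L²` of the circle when `b ∈ ℓ¹`. -/
theorem exists_filter_functional {b : ℕ → ℂ} (hb : Summable fun n => ‖b n‖) (t : ℝ) :
    ∃ Λ : Lp ℂ 2 (AddCircle.haarAddCircle (T := (Real.pi⁻¹ : ℝ))) →L[ℂ] ℂ, ∀ D, Λ D =
      𝓕⁻ (fun η : ℝ => D (η : FreqCircle) * (Real.pi * cascadeFilter b (2 * Real.pi * η))) t := by
  have hint : ∀ D : Lp ℂ 2 (AddCircle.haarAddCircle (T := (Real.pi⁻¹ : ℝ))), Integrable fun η : ℝ =>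
      D (η : FreqCircle) * (Real.pi * cascadeFilter b (2 * Real.pi * η)) := fun D =>
    ((integrable_periodic_mul_cascadeFilter hb (integrable_Lp_haarAddCircle D)).const_mul
      (Real.pi : ℂ)).congr (Eventually.of_forall fun η => by ring)
  have hw : Continuous fun η : ℝ => η * t := by fun_prop
  refine ⟨LinearMap.mkContinuous
    { toFun := fun D => 𝓕⁻ (fun η : ℝ => D (η : FreqCircle) *
        (Real.pi * cascadeFilter b (2 * Real.pi * η))) t
      map_add' := fun D E => ?_
      map_smul' := fun a D => ?_ } (∑' n, ‖b n‖) fun D => ?_, fun D => rfl⟩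
  · simp only [fourierInv_eq_integral_wave]
    rw [← integral_add (integrable_mul_wave (hint D) hw) (integrable_mul_wave (hint E) hw)]
    refine integral_congr_ae ?_
    filter_upwards [quasiMeasurePreserving_mk.ae (ae_freqCircle_iff.1 (Lp.coeFn_add D E))] with η hη
    rw [hη, Pi.add_apply]
    ring
  · simp only [fourierInv_eq_integral_wave, RingHom.id_apply, smul_eq_mul]
    rw [← integral_const_mul]
    refine integral_congr_ae ?_
    filter_upwards [quasiMeasurePreserving_mk.ae (ae_freqCircle_iff.1 (Lp.coeFn_smul a D))] with η hη
    rw [hη, Pi.smul_apply, smul_eq_mul]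
    ring
  · refine (norm_fourierInv_le t).trans ?_
    have h1 : ∀ η : ℝ, ‖D (η : FreqCircle) * (Real.pi * cascadeFilter b (2 * Real.pi * η))‖ =
        Real.pi * ‖D (η : FreqCircle) * cascadeFilter b (2 * Real.pi * η)‖ := by
      intro η
      rw [norm_mul, norm_mul, norm_mul, Complex.norm_real, Real.norm_of_nonneg Real.pi_pos.le]
      ring
    simp_rw [h1]
    rw [integral_const_mul, integral_norm_mul_cascadeFilter hb (integrable_Lp_haarAddCircle D)]
    have h2 := integral_norm_haarAddCircle_le D
    rw [AddCircle.integral_haarAddCircle, inv_inv, smul_eq_mul] at h2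
    have h3 : 0 ≤ ∑' n, ‖b n‖ := tsum_nonneg fun _ => norm_nonneg _
    calc _ = (∑' n, ‖b n‖) * (Real.pi * ∫ x, ‖D x‖) := by ring
      _ ≤ _ := by gcongr

/-- The cardinal series of an element of `V_F` converges pointwise for `b ∈ ℓ¹`: it is the image of
the Fourier series of the periodic factor under a bounded functional. -/
theorem hasSum_fourierCoeff_mul_sincRep {b : ℕ → ℂ} (hb : Summable fun n => ‖b n‖)
    (C : Lp ℂ 2 (AddCircle.haarAddCircle (T := (Real.pi⁻¹ : ℝ)))) (t : ℝ) :
    HasSum (fun k : ℤ => fourierCoeff C (-k) * sincRep b (t - k * Real.pi))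
      (𝓕⁻ (fun η : ℝ => C (η : FreqCircle) * (Real.pi * cascadeFilter b (2 * Real.pi * η))) t) := by
  obtain ⟨Λ, hΛ⟩ := exists_filter_functional hb t
  have h1 := (Equiv.neg ℤ).hasSum_iff.2 ((hasSum_fourier_series_L2 C).mapL Λ)
  rw [← hΛ]
  refine h1.congr_fun fun k => ?_
  simp only [Function.comp_apply, Equiv.neg_apply, map_smul, smul_eq_mul]
  congr 1
  rw [hΛ, sincRep, fourierInv_eq_integral_wave, fourierInv_eq_integral_wave, ← integral_const_mul]
  refine integral_congr_ae ?_
  filter_upwards [quasiMeasurePreserving_mk.ae (ae_freqCircle_iff.1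
    (coeFn_fourierLp (T := (Real.pi⁻¹ : ℝ)) 2 (-k)))] with η hη
  rw [hη, fourier_coe_eq_wave, show η * (t - k * Real.pi) = η * ((-k : ℤ) * Real.pi) + η * t by
    push_cast; ring, wave_add]
  ring

/-! ### The reproducing identities -/

/-- Pairing with a square-integrable function preserves `L²`-convergent series. -/
theorem hasSum_integral_mul {ι : Type*} {u : ι → Lp ℂ 2 (volume : Measure ℝ)}
    {f : Lp ℂ 2 (volume : Measure ℝ)} (hu : HasSum u f) {w : ℝ → ℂ} (hw : MemLp w 2 volume) :
    HasSum (fun i => ∫ x, u i x * w x) (∫ x, f x * w x) := by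
  refine hu.map (AddMonoidHom.mk' (fun h : Lp ℂ 2 (volume : Measure ℝ) => ∫ x, h x * w x)
    fun h h' => ?_) (continuous_integral_mul hw)
  rw [← integral_add (integrable_mul_of_memLp_two (Lp.memLp h) hw)
    (integrable_mul_of_memLp_two (Lp.memLp h') hw)]
  refine integral_congr_ae ?_
  filter_upwards [Lp.coeFn_add h h'] with x hx
  rw [hx, Pi.add_apply, add_mul]

/-- Values on `πℤ` can be prescribed within an almost-everywhere class. -/
theorem exists_ae_eq_apply_int_mul_pi (u : ℝ → ℂ) (c : ℤ → ℂ) :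
    ∃ g : ℝ → ℂ, g =ᵐ[volume] u ∧ ∀ k : ℤ, g (k * Real.pi) = c k := by
  have hinj : Function.Injective fun k : ℤ => (k : ℝ) * Real.pi := fun k l h => by
    exact_mod_cast mul_right_cancel₀ Real.pi_ne_zero h
  refine ⟨Function.extend (fun k : ℤ => (k : ℝ) * Real.pi) c u, ?_, hinj.extend_apply c u⟩
  have h := (Set.countable_range fun k : ℤ => (k : ℝ) * Real.pi).ae_notMem volume
  filter_upwards [h] with x hx
  exact Function.extend_apply' _ _ _ hx

/-- The delta form of the reproducing formula: the `L²` series of `f`, paired with a test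
function. -/
theorem hasSum_deltaTerm {s f : Lp ℂ 2 (volume : Measure ℝ)} {c : ℤ → ℂ}
    (hf : HasSum (fun n : ℤ => c n • translate (n * Real.pi) s) f) {g : ℝ → ℂ}
    (hg : ∀ k : ℤ, g (k * Real.pi) = c k) (ψ : 𝓢(ℝ, ℂ)) :
    HasSum (fun k : ℤ => deltaTerm s k (fun p => g p.1 * ψ p.2)) (∫ t : ℝ, f t * ψ t) := by
  refine (hasSum_integral_mul hf (ψ.memLp 2 volume)).congr_fun fun k => ?_
  refine integral_congr_ae ?_
  filter_upwards [Lp.coeFn_smul (c k) (translate (k * Real.pi) s),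
    coeFn_translate (k * Real.pi) s] with t h1 h2
  rw [h1, Pi.smul_apply, h2, smul_eq_mul, deltaTermAt, hg]
  ring

/-- The value of `f` at `x` is the value at `x` of the inverse Fourier integral when `𝓕 f` is
integrable. -/
theorem HasValueAt.eq_fourierInv {f : Lp ℂ 2 (volume : Measure ℝ)} {x : ℝ} {v : ℂ}
    (h : HasValueAt f x v) (hf : Integrable (𝓕 f : Lp ℂ 2 (volume : Measure ℝ))) :
    v = 𝓕⁻ ((𝓕 f : Lp ℂ 2 (volume : Measure ℝ)) : ℝ → ℂ) x := by
  have hw : (fun η : ℝ => ((𝓕 f : Lp ℂ 2 (volume : Measure ℝ)) : ℝ → ℂ) η *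
      Complex.exp (2 * Real.pi * Complex.I * η * x)) =
      fun η => ((𝓕 f : Lp ℂ 2 (volume : Measure ℝ)) : ℝ → ℂ) η * wave (η * x) := by
    ext η
    rw [wave]
    congr 2
    push_cast
    ring
  rw [HasValueAt, hw] at h
  rw [fourierInv_eq_integral_wave]
  exact tendsto_nhds_unique h (intervalIntegral_tendsto_integral
    (integrable_mul_wave hf (by fun_prop)) tendsto_neg_atTop_atBot tendsto_id)

/-- For `b ∈ ℓ¹` the continuous representative of `f ∈ V_F` satisfies both forms of the reproducing
identity at every point. -/
theorem exists_continuous_rep {b : lp (fun _ : ℕ => ℂ) 2}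
    (hb : Summable fun n => ‖(b : ℕ → ℂ) n‖) {f : Lp ℂ 2 (volume : Measure ℝ)} (hf : f ∈ VF b) :
    ∃ g : ℝ → ℂ, Continuous g ∧ g =ᵐ[volume] f ∧ ∀ t : ℝ,
      HasSum (fun k : ℤ => expTermAt (sincRep b) k t g) (g t) ∧
      HasSum (fun k : ℤ => deltaTermAt (sincRep b) k t g) (g t) := by
  obtain ⟨hb1, c, hc⟩ := hf
  obtain ⟨C, -, hC⟩ := exists_fourier_eq_periodic_mul (sincF b) f c hc
  have hsum : HasSum (b : ℕ → ℂ) 1 := by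
    have h := hb.of_norm.hasSum
    rwa [tendsto_nhds_unique h.tendsto_sum_nat hb1] at h
  have hH : (𝓕 f : Lp ℂ 2 (volume : Measure ℝ)) =ᵐ[volume]
      fun η => C (η : FreqCircle) * (Real.pi * cascadeFilter b (2 * Real.pi * η)) := by
    filter_upwards [hC, fourier_sincF b] with η h1 h2
    rw [h1, h2]
  have hF : Integrable (𝓕 f : Lp ℂ 2 (volume : Measure ℝ)) := by
    refine ((integrable_periodic_mul_cascadeFilter hb
      (integrable_Lp_haarAddCircle C)).const_mul (Real.pi : ℂ)).congr ?_
    filter_upwards [hH] with η hη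
    rw [hη]
    ring
  have hg : 𝓕⁻ ((𝓕 f : Lp ℂ 2 (volume : Measure ℝ)) : ℝ → ℂ) =ᵐ[volume] f := by
    have h := fourierInv_toLp_ae_eq hF (Lp.memLp _)
    rw [Lp.toLp_coeFn, FourierTransform.fourierInv_fourier_eq] at h
    exact h.symm
  refine ⟨𝓕⁻ ((𝓕 f : Lp ℂ 2 (volume : Measure ℝ)) : ℝ → ℂ), continuous_fourierInv hF, hg,
    fun t => ⟨?_, ?_⟩⟩
  · have h := hasSum_integral_mul_cascadeFilter_sub hb hsum
      (integrable_mul_wave hF (w := fun η => η * t) (by fun_prop))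
    simp only [mul_one] at h
    rw [fourierInv_eq_integral_wave]
    refine h.congr_fun fun k => ?_
    rw [expTermAt_eq_fourierInv b (sincRep_ae_eq hb) hg hC, fourierInv_eq_integral_wave]
    congr 1
    ext η
    ring
  · rw [Real.fourierInv_congr_ae hH]
    refine (hasSum_fourierCoeff_mul_sincRep hb C t).congr_fun fun k => ?_
    rw [deltaTermAt, ← (hasValueAt_of_fourier_eq hb1 hC k).eq_fourierInv hF]

end SincF

end

theorem mainTheorem4 (b : lp (fun _ : ℕ => ℂ) 2) :
    -- the kernel is a tempered distribution in `(x, t)`, given by either of the two series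
    (∃ Φ : 𝓢'(ℝ × ℝ, ℂ), ∀ φ : 𝓢(ℝ × ℝ, ℂ),
      HasSum (fun k : ℤ => SincF.expTerm (SincF.sincF b) k φ) (Φ φ) ∧
      HasSum (fun k : ℤ => SincF.deltaTerm (SincF.sincF b) k φ) (Φ φ)) ∧
    -- reproducing property in the sense of distributions in `t`, for both forms of the kernel
    (∀ f ∈ SincF.VF b, ∃ g : ℝ → ℂ, g =ᵐ[volume] f ∧
      (∀ k : ℤ, SincF.HasValueAt f (k * Real.pi) (g (k * Real.pi))) ∧
      ∀ ψ : 𝓢(ℝ, ℂ),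
        Tendsto (fun K : ℕ => ∑ k ∈ Finset.Icc (-(K : ℤ)) K,
            SincF.expTerm (SincF.sincF b) k (fun p => g p.1 * ψ p.2))
          atTop (𝓝 (∫ t : ℝ, f t * ψ t)) ∧
        HasSum (fun k : ℤ => SincF.deltaTerm (SincF.sincF b) k (fun p => g p.1 * ψ p.2))
          (∫ t : ℝ, f t * ψ t)) ∧
    -- for absolutely summable `b`: the kernel at each fixed `t`, and the identity at each `t`
    (Summable (fun n : ℕ => ‖(b : ℕ → ℂ) n‖) →
      ∃ s : ℝ → ℂ, Continuous s ∧ s =ᵐ[volume] SincF.sincF b ∧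
        (∀ t : ℝ, ∃ Φt : 𝓢'(ℝ, ℂ), ∀ φ : 𝓢(ℝ, ℂ),
          HasSum (fun k : ℤ => SincF.expTermAt s k t φ) (Φt φ) ∧
          HasSum (fun k : ℤ => SincF.deltaTermAt s k t φ) (Φt φ)) ∧
        ∀ f ∈ SincF.VF b, ∃ g : ℝ → ℂ, Continuous g ∧ g =ᵐ[volume] f ∧
          ∀ t : ℝ,
            HasSum (fun k : ℤ => SincF.expTermAt s k t g) (g t) ∧
            HasSum (fun k : ℤ => SincF.deltaTermAt s k t g) (g t)) := by
  refine ⟨SincF.exists_kernel_distribution (Lp.memLp _), ?_, fun hb =>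
    ⟨SincF.sincRep b, SincF.continuous_sincRep hb, SincF.sincRep_ae_eq hb,
      SincF.exists_kernel_distribution_at hb, fun f hf => SincF.exists_continuous_rep hb hf⟩⟩
  rintro f ⟨hb, c, hc⟩
  obtain ⟨C, hCc, hC⟩ := SincF.exists_fourier_eq_periodic_mul (SincF.sincF b) f c hc
  -- The samples of `f` are prescribed on the null set `πℤ`.
  obtain ⟨g, hgf, hg⟩ := SincF.exists_ae_eq_apply_int_mul_pi f c
  refine ⟨g, hgf, fun k => ?_, fun ψ => ⟨SincF.tendsto_sum_expTerm hb hC hgf ψ,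
    SincF.hasSum_deltaTerm hc hg ψ⟩⟩
  rw [hg, ← hCc]
  exact SincF.hasValueAt_of_fourier_eq hb hC k
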